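/- Let $R$ be a complete local noetherian reduced Cohen–Macaulay ring of Krull dimension one which is not regular, and let $\widetilde R$ be its normalization, i.e. its integral closure in its total ring of fractions $Q(R)$. A Cohen–Macaulay $R$-module is a finitely generated $R$-module $M$ with $\operatorname{depth} M=\dim R$, and the global spectrum of $R$ is $$\operatorname{gs}(R)=\{n\in\mathbb N : \text{there is a Cohen–Macaulay } R\text{-module } M \text{ with } \operatorname{gl.dim}\operatorname{End}_R(M)=n\}.$$ A noncommutative resolution (NCR) of $\operatorname{Spec}(R)$ is a ring $\operatorname{End}_R(M)$ of finite global dimension, with $M$ a finitely generated faithful $R$-module. Then $\{1,2\}\subseteq\operatorname{gs}(R)$, and there are NCRs of $\operatorname{Spec}(R)$ of global dimension $1$ and of global dimension $2$. Concretely: 1. $\widetilde R$ is a faithful Cohen–Macaulay $R$-module and $\operatorname{gl.dim}\operatorname{End}_R(\widetilde R)=1$. 2. There is a ring $S$ with $R\subseteq S\subseteq\widetilde R$ such that $S\oplus\widetilde R$ is a faithful Cohen–Macaulay $R$-module and $\operatorname{gl.dim}\operatorname{End}_R(S\oplus\widetilde R)=2$. -/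

import Mathlib

open CategoryTheory

universe u

noncomputable section

/-- The (left) global dimension of a (not necessarily commutative) ring: the supremum of the
projective dimensions of its modules. -/
def globalDimension (A : Type u) [Ring A] : WithBot ℕ∞ :=
  ⨆ N : ModuleCat.{u} A, projectiveDimension N

/-- The depth of a module `M` over a local ring with residue field `k`: the smallest `d` with
`Ext^d(k, M) ≠ 0` (and `⊤` if there is none). -/
def moduleDepth (R : Type u) [CommRing R] [IsLocalRing R]
    (M : Type u) [AddCommGroup M] [Module R M] : ℕ∞ :=
  ⨅ (d : ℕ) (_ : Nontrivial (Abelian.Ext (ModuleCat.of R (IsLocalRing.ResidueField R))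
    (ModuleCat.of R M) d)), (d : ℕ∞)

/-- (Maximal) Cohen-Macaulay modules over a local ring: finitely generated modules whose depth is
the Krull dimension of the ring. -/
structure IsCohenMacaulayModule (R : Type u) [CommRing R] [IsLocalRing R]
    (M : Type u) [AddCommGroup M] [Module R M] : Prop where
  finite : Module.Finite R M
  depth_eq : (moduleDepth R M : WithBot ℕ∞) = ringKrullDim R

/-- The global spectrum of a local ring: the natural numbers that occur as the global dimension of
the endomorphism ring of a Cohen-Macaulay module. -/
def globalSpectrum (R : Type u) [CommRing R] [IsLocalRing R] : Set ℕ :=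
  {n | ∃ (M : Type u) (_ : AddCommGroup M) (_ : Module R M),
    IsCohenMacaulayModule R M ∧ globalDimension (Module.End R M) = (n : WithBot ℕ∞)}

/-- `End_R(M)` is a noncommutative resolution of `Spec R`: the module `M` is finitely generated
and faithful, and its endomorphism ring has finite global dimension. -/
structure IsNoncommutativeResolution (R : Type u) [CommRing R]
    (M : Type u) [AddCommGroup M] [Module R M] : Prop where
  finite : Module.Finite R M
  faithful : FaithfulSMul R M
  globalDimension_lt : globalDimension (Module.End R M) < ⊤

/-- The normalization of `R`: its integral closure in its total ring of fractions. -/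
abbrev normalization (R : Type u) [CommRing R] : Subalgebra R (FractionRing R) :=
  integralClosure R (FractionRing R)

end

/-! Let `B` be the normalization and `Q` the total ring of fractions of `R`. An `R`-linear map
between overrings of `R` in `Q` is multiplication by its value at 1, so `End_R(B) = B`. This ring is
reduced, one-dimensional and integrally closed in `Q`. It is also noetherian, because completeness
makes `B` finite over `R`: a Krull–Akizuki length bound makes `B/xB` finite for a regular `x`, and
reducedness makes `B` separated. Ideals of `B` containing a regular element are then invertible, all
ideals are projective, and the global dimension is 1.

For dimension 2, take `S` maximal among the proper `R`-subalgebras of `B`; one exists because `R ≠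
B` when `R` is not regular. Let `C` be the conductor of `S` in `B`. Then `End_R(S ⊕ B)` is the ring
of matrices with rows `(S, C)` and `(B, B)`, and maximality of `S` makes `C` a maximal ideal of `S`.

Upper bound: a submodule `K` of a free module consists of columns over a `B`-module. If `N` is its
lower part, `K` contains the column module `(CN, N)`, which is projective because `N` is projective
over `B`. The quotient is a vector space over `S/C`, that is, a direct sum of copies of first column
modulo second column, so it has projective dimension at most 1. Hence so has `K`.

Lower bound: if the order were hereditary, the column module `(C, C)` would be projective, and a
dual basis would give `C = C²`. Nakayama excludes this, since `C` is proper and contains a regular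
element. -/

/-! ### Global dimension and projective dimension of modules -/

theorem globalDimension_le_iff {A : Type u} [Ring A] (n : ℕ) :
    globalDimension A ≤ n ↔ ∀ N : ModuleCat.{u} A, HasProjectiveDimensionLE N n := by
  simp [globalDimension, iSup_le_iff, projectiveDimension_le_iff]

attribute [local instance] RingHomInvPair.of_ringEquiv in
theorem globalDimension_le_of_ringEquiv {A B : Type u} [Ring A] [Ring B] (e : A ≃+* B) :
    globalDimension A ≤ globalDimension B := by
  refine iSup_le fun N => ?_
  let N' : ModuleCat.{u} B :=
    letI := Module.compHom N e.symm.toRingHom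
    ModuleCat.of B N
  let e' : N ≃ₛₗ[RingHomClass.toRingHom e] N' :=
    { AddEquiv.refl N with
      map_smul' := fun a x => by
        change a • x = e.symm (e a) • x
        rw [e.symm_apply_apply] }
  rw [ModuleCat.projectiveDimension_eq_of_semiLinearEquiv e e']
  exact le_iSup (fun N : ModuleCat.{u} B => projectiveDimension N) N'

theorem globalDimension_eq_of_ringEquiv {A B : Type u} [Ring A] [Ring B] (e : A ≃+* B) :
    globalDimension A = globalDimension B :=
  le_antisymm (globalDimension_le_of_ringEquiv e) (globalDimension_le_of_ringEquiv e.symm)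

section

variable {A : Type u} [Ring A]

theorem shortExact_subtype_mkQ {P : Type u} [AddCommGroup P] [Module A P] (K : Submodule A P) :
    (ModuleCat.shortComplexOfCompEqZero K.subtype K.mkQ
      (by ext; simp)).ShortExact :=
  ModuleCat.shortComplex_shortExact _
    (fun x => by simp [ModuleCat.shortComplexOfCompEqZero])
    Subtype.val_injective (Submodule.mkQ_surjective _)

theorem hasProjectiveDimensionLE_succ_of_ker {P V : Type u} [AddCommGroup P] [Module A P]
    [Module.Projective A P] [AddCommGroup V] [Module A V] (f : P →ₗ[A] V)
    (hf : Function.Surjective f) (n : ℕ)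
    (h : HasProjectiveDimensionLE (ModuleCat.of A (LinearMap.ker f)) n) :
    HasProjectiveDimensionLE (ModuleCat.of A V) (n + 1) := by
  have : Projective (ModuleCat.of A P) := ModuleCat.projective_of_categoryTheory_projective _
  exact ((LinearMap.shortExact_shortComplexKer hf).hasProjectiveDimensionLT_X₃_iff n this).2 h

theorem hasProjectiveDimensionLE_one_of_projective_ker {P V : Type u} [AddCommGroup P]
    [Module A P] [Module.Projective A P] [AddCommGroup V] [Module A V] (f : P →ₗ[A] V)
    (hf : Function.Surjective f) (h : Module.Projective A (LinearMap.ker f)) :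
    HasProjectiveDimensionLE (ModuleCat.of A V) 1 :=
  hasProjectiveDimensionLE_succ_of_ker f hf 0
    ((projective_iff_hasProjectiveDimensionLE_zero _).1 ((IsProjective.iff_projective _).1 h))

theorem hasProjectiveDimensionLE_of_submodule {K : Type u} [AddCommGroup K] [Module A K]
    (W : Submodule A K) (n : ℕ) (hW : HasProjectiveDimensionLE (ModuleCat.of A W) n)
    (hV : HasProjectiveDimensionLE (ModuleCat.of A (K ⧸ W)) n) :
    HasProjectiveDimensionLE (ModuleCat.of A K) n :=
  (shortExact_subtype_mkQ W).hasProjectiveDimensionLT_X₂ (n + 1) hW hV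

theorem hasProjectiveDimensionLE_of_linearEquiv {M N : Type u} [AddCommGroup M] [Module A M]
    [AddCommGroup N] [Module A N] (e : M ≃ₗ[A] N) (n : ℕ)
    (h : HasProjectiveDimensionLE (ModuleCat.of A M) n) :
    HasProjectiveDimensionLE (ModuleCat.of A N) n :=
  hasProjectiveDimensionLT_of_iso e.toModuleIso (n + 1)

theorem globalDimension_le_succ_of_submodule_finsupp (n : ℕ)
    (h : ∀ (X : Type u) (K : Submodule A (X →₀ A)),
      HasProjectiveDimensionLE (ModuleCat.of A K) n) :
    globalDimension A ≤ (n + 1 : ℕ) := by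
  refine (globalDimension_le_iff (A := A) (n + 1)).2 fun N => ?_
  exact hasProjectiveDimensionLE_succ_of_ker (Finsupp.linearCombination A (id : N → N))
    (Finsupp.linearCombination_id_surjective A N) n (h _ _)

theorem projective_submodule_of_globalDimension_le_one (h : globalDimension A ≤ 1)
    {P : Type u} [AddCommGroup P] [Module A P] [Module.Projective A P] (K : Submodule A P) :
    Module.Projective A K := by
  have h' := (globalDimension_le_iff (A := A) 1).1 (by exact_mod_cast h)
  have hS := shortExact_subtype_mkQ K
  rw [IsProjective.iff_projective, projective_iff_hasProjectiveDimensionLT_one]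
  have : Projective (ModuleCat.of A P) := ModuleCat.projective_of_categoryTheory_projective _
  exact (hS.hasProjectiveDimensionLT_X₃_iff 0 this).1 (h' _)

/-- Baer's criterion: a map from an ideal to the quotient lifts to `E` because the ideal is
projective, and the lift extends because `E` is injective. -/
theorem injective_quotient_of_projective_ideals
    (h : ∀ I : Submodule A A, Module.Projective A I)
    {E E' : Type u} [AddCommGroup E] [Module A E] [AddCommGroup E'] [Module A E']
    [hE : Module.Injective A E] (q : E →ₗ[A] E') (hq : Function.Surjective q) :
    Module.Injective A E' := by
  rw [← Module.Baer.iff_injective] at *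
  intro I g
  have := h I
  obtain ⟨l, hl⟩ := Module.projective_lifting_property q g hq
  obtain ⟨g', hg'⟩ := hE I l
  exact ⟨q ∘ₗ g', fun x hx => by simp [hg' x hx, ← hl]⟩

/-- Working on the injective side reduces the question to ideals: quotients of injectives are
injective, so every module has injective dimension at most 1 and `Ext` vanishes from degree 2 on. -/
theorem globalDimension_le_one_of_projective_ideals
    (h : ∀ I : Submodule A A, Module.Projective A I) : globalDimension A ≤ 1 := by
  have key : ∀ Y : ModuleCat.{u} A, HasInjectiveDimensionLT Y 2 := by
    intro Y
    let ⟨E, _, f, _⟩ := EnoughInjectives.presentation Y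
    have hE : Module.Injective A E := Module.injective_module_of_injective_object A E
    have injf : Function.Injective f.hom := (ModuleCat.mono_iff_injective f).mp ‹_›
    let S : ShortComplex (ModuleCat.{u} A) :=
      ModuleCat.shortComplexOfCompEqZero _ _ f.hom.exact_map_mkQ_range.linearMap_comp_eq_zero
    have hS := ModuleCat.shortComplex_shortExact S
      f.hom.exact_map_mkQ_range injf (Submodule.mkQ_surjective _)
    refine (hS.hasInjectiveDimensionLT_X₃_iff 0 ‹_›).1 ?_
    have := injective_quotient_of_projective_ideals h f.hom.range.mkQ (Submodule.mkQ_surjective _)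
    have := Module.injective_object_of_injective_module A (E ⧸ f.hom.range)
    exact injective_iff_hasInjectiveDimensionLT_one.1 this
  refine (globalDimension_le_iff (A := A) 1).2 fun N => ?_
  refine HasProjectiveDimensionLT.mk fun i hi Y e => ?_
  have := key Y
  exact e.eq_zero_of_hasInjectiveDimensionLT 2 hi

end

instance Module.Projective.finsupp {A : Type*} [Semiring A] {P : Type*} [AddCommMonoid P]
    [Module A P] [Module.Projective A P] (J : Type*) : Module.Projective A (J →₀ P) := by
  classical
  exact Module.Projective.of_equiv' (finsuppLequivDFinsupp (ι := J) (M := P) A).symm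

section

/-- The family `k` lifts a basis of the `S/𝔫`-vector space `M/N`; the two conclusions are linear
independence and spanning, stated over `S`. -/
theorem exists_lift_basis_of_isMaximal {S : Type u} [CommRing S] (𝔫 : Ideal S) [𝔫.IsMaximal]
    {M : Type u} [AddCommGroup M] [Module S M] (N : Submodule S M)
    (hN : ∀ a ∈ 𝔫, ∀ m : M, a • m ∈ N) :
    ∃ (J : Type u) (k : J → M),
      (∀ a : J →₀ S, (a.sum fun j s => s • k j) ∈ N → ∀ j, a j ∈ 𝔫) ∧
      ∀ m : M, ∃ a : J →₀ S, m - (a.sum fun j s => s • k j) ∈ N := by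
  let := Ideal.Quotient.field 𝔫
  have htors : Module.IsTorsionBySet S (M ⧸ N) 𝔫 := by
    rintro x ⟨a, ha⟩
    obtain ⟨m, rfl⟩ := N.mkQ_surjective x
    change a • N.mkQ m = 0
    rw [← map_smul]
    exact (Submodule.Quotient.mk_eq_zero N).2 (hN a ha m)
  let : Module (S ⧸ 𝔫) (M ⧸ N) := htors.module
  let b := Module.Basis.ofVectorSpace (S ⧸ 𝔫) (M ⧸ N)
  choose k hk using fun j => N.mkQ_surjective (b j)
  have hsum : ∀ a : Module.Basis.ofVectorSpaceIndex (S ⧸ 𝔫) (M ⧸ N) →₀ S,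
      N.mkQ (a.sum fun j s => s • k j) =
        Finsupp.linearCombination (S ⧸ 𝔫) b (a.mapRange (Ideal.Quotient.mk 𝔫) (map_zero _)) := by
    intro a
    rw [Finsupp.linearCombination_apply, Finsupp.sum_mapRange_index (by simp), Finsupp.sum,
      map_sum, Finsupp.sum]
    exact Finset.sum_congr rfl fun j _ => by rw [map_smul, hk]; rfl
  refine ⟨_, k, fun a ha j => ?_, fun m => ?_⟩
  · have h0 := hsum a
    rw [(by simpa using ha : N.mkQ (a.sum fun j s => s • k j) = 0)] at h0
    have := DFunLike.congr_fun (linearIndependent_iff.1 b.linearIndependent _ h0.symm) j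
    simpa [Ideal.Quotient.eq_zero_iff_mem] using this
  · obtain ⟨a, ha⟩ := Finsupp.mapRange_surjective (Ideal.Quotient.mk 𝔫) (map_zero _)
      Ideal.Quotient.mk_surjective (b.repr (N.mkQ m))
    refine ⟨a, ?_⟩
    refine (Submodule.Quotient.mk_eq_zero N).1 ?_
    change N.mkQ _ = 0
    rw [map_sub, hsum, ha, Module.Basis.linearCombination_repr, sub_self]

end

/-! ### The conductor order and its projective column modules -/

open scoped Matrix.Module

/-- The ring of matrices `!![s, c; b, b']` over `B` with `s ∈ S` and `c ∈ C`, where `C` is an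
ideal of `B` contained in the subring `S`. -/
def conductorOrder {B : Type u} [CommRing B] (S : Subring B) (C : Ideal B) (hC : ∀ c ∈ C, c ∈ S) :
    Subring (Matrix (Fin 2) (Fin 2) B) where
  carrier := {X | X 0 0 ∈ S ∧ X 0 1 ∈ C}
  mul_mem' := by
    rintro X Y ⟨h1, h2⟩ ⟨h3, h4⟩
    simp only [Set.mem_ofPred_eq, Matrix.mul_apply, Fin.sum_univ_two]
    exact ⟨add_mem (mul_mem h1 h3) (hC _ (C.mul_mem_right _ h2)),
      add_mem (C.mul_mem_left _ h4) (C.mul_mem_right _ h2)⟩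
  one_mem' := by simp
  add_mem' := by
    rintro X Y ⟨h1, h2⟩ ⟨h3, h4⟩
    exact ⟨add_mem h1 h3, add_mem h2 h4⟩
  zero_mem' := by simp
  neg_mem' := by
    rintro X ⟨h1, h2⟩
    exact ⟨neg_mem h1, neg_mem h2⟩

namespace conductorOrder

variable {B : Type u} [CommRing B] {S : Subring B} {C : Ideal B} {hC : ∀ c ∈ C, c ∈ S}
  {F : Type u} [AddCommGroup F] [Module B F]

/-- The element `!![s, c; b, d]` of the conductor order. -/
def mk (s : B) (hs : s ∈ S) (c : B) (hc : c ∈ C) (b d : B) : conductorOrder S C hC :=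
  ⟨!![s, c; b, d], hs, hc⟩

instance (priority := high) : Module (conductorOrder S C hC) (Fin 2 → F) := inferInstance

instance (priority := high) (P : Submodule (conductorOrder S C hC) (Fin 2 → F)) :
    SMul (conductorOrder S C hC) P := P.smul

theorem smul_apply (X : conductorOrder S C hC) (w : Fin 2 → F) (i : Fin 2) :
    (X • w) i = X.1 i 0 • w 0 + X.1 i 1 • w 1 := by
  change (X.1 • w) i = _
  simp [Fin.sum_univ_two]

@[simp] theorem mk_smul (s : B) (hs : s ∈ S) (c : B) (hc : c ∈ C) (b d : B) (v w : F) :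
    (mk s hs c hc b d : conductorOrder S C hC) • ![v, w] =
      ![s • v + c • w, b • v + d • w] := by
  ext i
  rw [smul_apply]
  fin_cases i <;> simp [mk]

variable (hC) in
/-- Columns whose second entry lies in `F'` and whose first entry lies in `C • F'`. -/
def idealColumn (F' : Submodule B F) : Submodule (conductorOrder S C hC) (Fin 2 → F) where
  carrier := {w | w 0 ∈ C • F' ∧ w 1 ∈ F'}
  add_mem' := fun h1 h2 => ⟨add_mem h1.1 h2.1, add_mem h1.2 h2.2⟩
  zero_mem' := ⟨zero_mem _, zero_mem _⟩
  smul_mem' := by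
    rintro X w ⟨h1, h2⟩
    simp only [Set.mem_ofPred_eq, smul_apply]
    exact ⟨add_mem (Submodule.smul_mem _ _ h1) (Submodule.smul_mem_smul X.2.2 h2),
      add_mem (F'.smul_mem _ (Submodule.smul_le_right h1)) (F'.smul_mem _ h2)⟩

theorem mem_idealColumn {F' : Submodule B F} {w : Fin 2 → F} :
    w ∈ idealColumn hC F' ↔ w 0 ∈ C • F' ∧ w 1 ∈ F' := Iff.rfl

variable (S C hC) in
/-- The first column of the conductor order. -/
def firstColumn : Submodule (conductorOrder S C hC) (Fin 2 → B) where
  carrier := {w | w 0 ∈ S}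
  add_mem' := fun h1 h2 => add_mem (S := Subring B) h1 h2
  zero_mem' := zero_mem S
  smul_mem' := by
    intro X w h
    simp only [Set.mem_ofPred_eq, smul_apply]
    exact add_mem (mul_mem X.2.1 h) (hC _ (C.mul_mem_right _ X.2.2))

variable (S C hC) in
/-- The second column of the conductor order. -/
abbrev secondColumn : Submodule (conductorOrder S C hC) (Fin 2 → B) := idealColumn hC ⊤

theorem mem_secondColumn {w : Fin 2 → B} : w ∈ secondColumn S C hC ↔ w 0 ∈ C := by
  simp [secondColumn, mem_idealColumn]

theorem secondColumn_le : secondColumn S C hC ≤ firstColumn S C hC :=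
  fun _ h => hC _ (mem_secondColumn.1 h)

instance projective_firstColumn : Module.Projective (conductorOrder S C hC)
    (firstColumn S C hC) := by
  let i : firstColumn S C hC →ₗ[conductorOrder S C hC] conductorOrder S C hC :=
    { toFun := fun w => mk (w.1 0) w.2 0 C.zero_mem (w.1 1) 0
      map_add' := fun v w => by ext i j; fin_cases i <;> fin_cases j <;> simp [mk]
      map_smul' := fun X w => by
        ext i j
        fin_cases i <;> fin_cases j <;> simp [mk, smul_apply, Matrix.mul_apply] }
  let p : conductorOrder S C hC →ₗ[conductorOrder S C hC] firstColumn S C hC :=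
    { toFun := fun X => ⟨fun i => X.1 i 0, X.2.1⟩
      map_add' := fun v w => rfl
      map_smul' := fun X Y => by
        ext i
        simp [smul_apply, Matrix.mul_apply] }
  refine Module.Projective.of_split i p ?_
  ext w i
  fin_cases i <;> rfl

instance projective_secondColumn : Module.Projective (conductorOrder S C hC)
    (secondColumn S C hC) := by
  let i : secondColumn S C hC →ₗ[conductorOrder S C hC] conductorOrder S C hC :=
    { toFun := fun w => mk 0 S.zero_mem (w.1 0) (mem_secondColumn.1 w.2) 0 (w.1 1)
      map_add' := fun v w => by ext i j; fin_cases i <;> fin_cases j <;> simp [mk]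
      map_smul' := fun X w => by
        ext i j
        fin_cases i <;> fin_cases j <;> simp [mk, smul_apply, Matrix.mul_apply] }
  let p : conductorOrder S C hC →ₗ[conductorOrder S C hC] secondColumn S C hC :=
    { toFun := fun X => ⟨fun i => X.1 i 1, mem_secondColumn.2 X.2.2⟩
      map_add' := fun v w => rfl
      map_smul' := fun X Y => by
        ext i
        simp [smul_apply, Matrix.mul_apply] }
  refine Module.Projective.of_split i p ?_
  ext w i
  fin_cases i <;> rfl

/-- Scaling a fixed vector by the entries of a column. -/
def columnSMul (v : F) : (Fin 2 → B) →ₗ[conductorOrder S C hC] (Fin 2 → F) where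
  toFun w i := w i • v
  map_add' w w' := by ext i; simp [add_smul]
  map_smul' X w := by ext i; simp [smul_apply, add_smul, mul_smul]

theorem sum_columnSMul_apply {J : Type u} (k : J → F)
    (P : Submodule (conductorOrder S C hC) (Fin 2 → B)) (p : J →₀ P) (i : Fin 2) :
    Finsupp.lsum ℕ (fun j => columnSMul (hC := hC) (k j) ∘ₗ P.subtype) p i =
      p.sum fun j w => w.1 i • k j := by
  simp [Finsupp.sum, columnSMul]

theorem _root_.LinearMap.apply_mem_of_mem_smul (F' : Submodule B F) (φ : F' →ₗ[B] B) (x : F')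
    (hx : (x : F) ∈ C • F') : φ x ∈ C := by
  have h1 : x ∈ C • (⊤ : Submodule B F') := by
    have : C • F' = (C • (⊤ : Submodule B F')).map F'.subtype := by
      rw [Submodule.map_smul'', Submodule.map_subtype_top]
    rw [this] at hx
    obtain ⟨y, hy, hyx⟩ := hx
    exact (Subtype.ext hyx : y = x) ▸ hy
  have h2 := Submodule.mem_map_of_mem (f := φ) h1
  rw [Submodule.map_smul''] at h2
  simpa using smul_mono_right C (le_top : _ ≤ (⊤ : Submodule B B)) h2

/-- A section `s` of the free cover of `F'`, applied to both entries, exhibits the column module as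
a summand of a direct sum of second columns. Coordinates of the first entry land in `C` because a
functional on `F'` maps `C • F'` into `C`. -/
theorem projective_idealColumn (F' : Submodule B F) [Module.Projective B F'] :
    Module.Projective (conductorOrder S C hC) (idealColumn hC F') := by
  classical
  obtain ⟨s, hs⟩ := Module.projective_def'.1 (inferInstance : Module.Projective B F')
  have hmem : ∀ (w : idealColumn hC F') (i : Fin 2), w.1 i ∈ F' := fun w i => by
    fin_cases i
    · exact Submodule.smul_le_right w.2.1
    · exact w.2.2
  let t (w : idealColumn hC F') (i : Fin 2) : F' →₀ B := s ⟨w.1 i, hmem w i⟩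
  let c (w : idealColumn hC F') (v : F') : secondColumn S C hC :=
    ⟨fun i => t w i v, mem_secondColumn.2
      (LinearMap.apply_mem_of_mem_smul F' (Finsupp.lapply v ∘ₗ s) _ w.2.1)⟩
  have hc : ∀ w v, c w v ≠ 0 → v ∈ (t w 0).support ∪ (t w 1).support := by
    intro w v hv
    by_contra h
    simp only [Finset.mem_union, Finsupp.mem_support_iff, not_or, not_not] at h
    apply hv
    ext i
    fin_cases i
    · exact h.1
    · exact h.2
  let i : idealColumn hC F' →ₗ[conductorOrder S C hC] F' →₀ secondColumn S C hC :=
    { toFun := fun w => Finsupp.onFinset ((t w 0).support ∪ (t w 1).support) (c w) (hc w)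
      map_add' := fun v w => by
        ext x i
        have : t (v + w) i = t v i + t w i := by
          rw [← map_add]; rfl
        change t (v + w) i x = t v i x + t w i x
        rw [this, Finsupp.add_apply]
      map_smul' := fun X w => by
        ext x i
        have : t (X • w : idealColumn hC F') i = X.1 i 0 • t w 0 + X.1 i 1 • t w 1 := by
          rw [← map_smul, ← map_smul, ← map_add]
          exact congr_arg s (Subtype.ext (smul_apply X w.1 i))
        change t (X • w) i x = _
        rw [this]
        simp [smul_apply, c] }
  let p : (F' →₀ secondColumn S C hC) →ₗ[conductorOrder S C hC] (Fin 2 → F) :=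
    Finsupp.lsum ℕ fun v : F' => columnSMul (v : F) ∘ₗ (secondColumn S C hC).subtype
  have hp : ∀ x, p x ∈ idealColumn hC F' := by
    intro x
    refine ⟨?_, ?_⟩
    · rw [sum_columnSMul_apply]
      exact sum_mem fun v _ => Submodule.smul_mem_smul (mem_secondColumn.1 (x v).2) v.2
    · rw [sum_columnSMul_apply]
      exact sum_mem fun v _ => F'.smul_mem _ v.2
  refine Module.Projective.of_split i (p.codRestrict _ hp) ?_
  ext w j
  change p (i w) j = w.1 j
  rw [sum_columnSMul_apply]
  have h1 := congr_arg F'.subtype (LinearMap.congr_fun hs ⟨w.1 j, hmem w j⟩)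
  change F'.subtype (Finsupp.linearCombination B id (t w j)) = w.1 j at h1
  rw [← h1, Finsupp.linearCombination_apply, Finsupp.sum.eq_1 (t w j), map_sum]
  rw [Finsupp.sum_of_support_subset (s := (t w 0).support ∪ (t w 1).support)]
  · symm
    refine Finset.sum_subset ?_ ?_
    · fin_cases j
      · exact Finset.subset_union_left
      · exact Finset.subset_union_right
    · intro v _ hv
      simp [Finsupp.notMem_support_iff.1 hv]
  · exact Finsupp.support_onFinset_subset (hf := hc w)
  · simp

/-! ### Upper bound: submodules of column modules -/

section UpperBound

variable (K : Submodule (conductorOrder S C hC) (Fin 2 → F))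

/-- The vectors `v` such that the column `![0, v]` lies in `K`. -/
def lowerPart : Submodule B F where
  carrier := {v | ![0, v] ∈ K}
  add_mem' := fun {v w} hv hw => by simpa using K.add_mem hv hw
  zero_mem' := by
    change ![0, 0] ∈ K
    convert K.zero_mem
    ext i; fin_cases i <;> rfl
  smul_mem' := fun b v hv => by
    simpa using K.smul_mem (mk 0 S.zero_mem 0 C.zero_mem 0 b) hv

/-- The vectors `v` such that the column `![v, 0]` lies in `K`. -/
def upperPart : Submodule S F where
  carrier := {v | ![v, 0] ∈ K}
  add_mem' := fun {v w} hv hw => by simpa using K.add_mem hv hw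
  zero_mem' := by
    change ![0, 0] ∈ K
    convert K.zero_mem
    ext i; fin_cases i <;> rfl
  smul_mem' := fun b v hv => by
    simpa using! K.smul_mem (mk b.1 b.2 0 C.zero_mem 0 0) hv

variable {K}

theorem mem_lowerPart {v : F} : v ∈ lowerPart K ↔ ![0, v] ∈ K := Iff.rfl

theorem mem_upperPart {v : F} : v ∈ upperPart K ↔ ![v, 0] ∈ K := Iff.rfl

theorem upperPart_le {v : F} (hv : v ∈ upperPart K) : v ∈ lowerPart K := by
  simpa [mem_lowerPart] using K.smul_mem (mk 0 S.zero_mem 0 C.zero_mem 1 0) hv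

theorem apply_zero_mem_upperPart {w : Fin 2 → F} (hw : w ∈ K) : w 0 ∈ upperPart K := by
  rw [← List.ofFn_inj.1 (by simp : List.ofFn ![w 0, w 1] = List.ofFn w)] at hw
  simpa [mem_upperPart] using K.smul_mem (mk 1 S.one_mem 0 C.zero_mem 0 0) hw

theorem apply_one_mem_lowerPart {w : Fin 2 → F} (hw : w ∈ K) : w 1 ∈ lowerPart K := by
  rw [← List.ofFn_inj.1 (by simp : List.ofFn ![w 0, w 1] = List.ofFn w)] at hw
  simpa [mem_lowerPart] using K.smul_mem (mk 0 S.zero_mem 0 C.zero_mem 0 1) hw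

theorem mem_of_parts {w : Fin 2 → F} (h0 : w 0 ∈ upperPart K) (h1 : w 1 ∈ lowerPart K) :
    w ∈ K := by
  have := K.add_mem (mem_upperPart.1 h0) (mem_lowerPart.1 h1)
  convert this
  ext i; fin_cases i <;> simp

theorem smul_lowerPart_le {v : F} (hv : v ∈ C • lowerPart K) : v ∈ upperPart K := by
  refine Submodule.smul_induction_on hv (fun c hc n hn => ?_) fun x y hx hy => add_mem hx hy
  simpa [mem_upperPart] using K.smul_mem (mk 0 S.zero_mem c hc 0 0) hn

theorem idealColumn_le : idealColumn hC (lowerPart K) ≤ K := fun _ hw =>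
  mem_of_parts (smul_lowerPart_le hw.1) hw.2

/-- `K` is an extension of `K/W` by the projective column module `W = (CN, N)`, with `N` the lower
part. Only the upper entry survives in `K/W`, where it lives in a vector space over `S/C`. Lifting a
basis indexed by `J` resolves `K/W` by `J` copies of the first column with kernel `J` copies of the
second. -/
theorem hasProjectiveDimensionLE_one_submodule (hmax : (C.comap S.subtype).IsMaximal)
    [Module.Projective B (lowerPart K)] :
    HasProjectiveDimensionLE (ModuleCat.of (conductorOrder S C hC) K) 1 := by
  have hW := projective_idealColumn (hC := hC) (lowerPart K)
  set W : Submodule (conductorOrder S C hC) K := (idealColumn hC (lowerPart K)).submoduleOf K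
    with hWdef
  have hW' : Module.Projective (conductorOrder S C hC) W :=
    Module.Projective.of_equiv (Submodule.submoduleOfEquivOfLe idealColumn_le).symm
  refine hasProjectiveDimensionLE_of_submodule W 1 ?_ ?_
  · have := ModuleCat.projective_of_categoryTheory_projective
      (ModuleCat.of (conductorOrder S C hC) W)
    infer_instance
  let N : Submodule S (upperPart K) :=
    ((C • lowerPart K).restrictScalars S).comap (upperPart K).subtype
  obtain ⟨J, k, hk1, hk2⟩ := exists_lift_basis_of_isMaximal (C.comap S.subtype) N
    (fun a ha m => Submodule.smul_mem_smul ha (upperPart_le m.2))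
  let g₀ : (J →₀ firstColumn S C hC) →ₗ[conductorOrder S C hC] (Fin 2 → F) :=
    Finsupp.lsum ℕ fun j => columnSMul (k j : F) ∘ₗ (firstColumn S C hC).subtype
  have hg₀ : ∀ p, g₀ p ∈ K := by
    intro p
    apply mem_of_parts
    · rw [sum_columnSMul_apply]
      exact sum_mem fun j _ => (upperPart K).smul_mem (⟨_, (p j).2⟩ : S) (k j).2
    · rw [sum_columnSMul_apply]
      exact sum_mem fun j _ => (lowerPart K).smul_mem _ (upperPart_le (k j).2)
  let g : (J →₀ firstColumn S C hC) →ₗ[conductorOrder S C hC] (K ⧸ W) :=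
    W.mkQ ∘ₗ g₀.codRestrict K hg₀
  have hker : ∀ p, p ∈ LinearMap.ker g ↔ g₀ p 0 ∈ C • lowerPart K := by
    intro p
    have h1 : p ∈ LinearMap.ker g ↔ g₀ p ∈ idealColumn hC (lowerPart K) := by
      simp [g, hWdef]; rfl
    rw [h1, mem_idealColumn]
    exact and_iff_left (apply_one_mem_lowerPart (hg₀ p))
  let e : (J →₀ secondColumn S C hC) →ₗ[conductorOrder S C hC] (J →₀ firstColumn S C hC) :=
    Finsupp.mapRange.linearMap (Submodule.inclusion secondColumn_le)
  have he : Function.Injective e :=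
    Finsupp.mapRange_injective _ (map_zero _) (Submodule.inclusion_injective _)
  have hrange : LinearMap.range e = LinearMap.ker g := by
    ext p
    rw [hker, sum_columnSMul_apply]
    constructor
    · rintro ⟨q, rfl⟩
      refine sum_mem fun j _ => Submodule.smul_mem_smul ?_ (upperPart_le (k j).2)
      exact mem_secondColumn.1 (q j).2
    · intro h
      -- Independence of the lifted basis modulo `C` forces every coefficient into `C`.
      have hp : ∀ j, (p j).1 0 ∈ C := by
        let a : J →₀ S := p.mapRange (fun w => (⟨w.1 0, w.2⟩ : S)) rfl
        refine hk1 a ?_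
        change ((a.sum fun j s => s • k j : upperPart K) : F) ∈ C • lowerPart K
        convert h
        rw [Finsupp.sum_mapRange_index (by simp), Finsupp.sum, Finsupp.sum]
        simp [Subring.smul_def]
      refine ⟨Finsupp.onFinset p.support (fun j => ⟨(p j).1, mem_secondColumn.2 (hp j)⟩) ?_, ?_⟩
      · intro j hj
        rw [Finsupp.mem_support_iff]
        rintro h0
        apply hj
        simp [h0]
      · ext j i
        rfl
  have hproj : Module.Projective (conductorOrder S C hC) (LinearMap.ker g) :=
    Module.Projective.of_equiv ((LinearEquiv.ofInjective e he).trans (LinearEquiv.ofEq _ _ hrange))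
  refine hasProjectiveDimensionLE_one_of_projective_ker
    (P := J →₀ firstColumn S C hC) (V := K ⧸ W) g ?_ hproj
  intro x
  obtain ⟨w, rfl⟩ := W.mkQ_surjective x
  obtain ⟨a, ha⟩ := hk2 ⟨w.1 0, apply_zero_mem_upperPart w.2⟩
  let p : J →₀ firstColumn S C hC :=
    a.mapRange (fun s => ⟨![s.1, 0], s.2⟩) (by ext i; fin_cases i <;> rfl)
  refine ⟨p, ?_⟩
  rw [← sub_eq_zero, ← neg_eq_zero, neg_sub]
  change W.mkQ w - W.mkQ (g₀.codRestrict K hg₀ p) = 0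
  rw [← map_sub]
  refine (Submodule.Quotient.mk_eq_zero W).2 ⟨?_, ?_⟩
  · change w.1 0 - g₀ p 0 ∈ C • lowerPart K
    change w.1 0 - ((a.sum fun j s => s • k j : upperPart K) : F) ∈ C • lowerPart K at ha
    convert ha using 2
    rw [sum_columnSMul_apply, Finsupp.sum_mapRange_index (by simp), Finsupp.sum, Finsupp.sum]
    simp [Subring.smul_def]
  · exact apply_one_mem_lowerPart (w - g₀.codRestrict K hg₀ p).2

end UpperBound

theorem globalDimension_le_two (hmax : (C.comap S.subtype).IsMaximal)
    (hB : globalDimension B ≤ 1) : globalDimension (conductorOrder S C hC) ≤ 2 := by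
  refine globalDimension_le_succ_of_submodule_finsupp 1 fun X K => ?_
  -- A free module embeds into columns over `X →₀ B × B`: entry `i` collects the `i`-th rows of the
  -- matrices.
  let i : (X →₀ conductorOrder S C hC) →ₗ[conductorOrder S C hC] (Fin 2 → X →₀ B × B) :=
    { toFun := fun f i => f.mapRange (fun M => (M.1 i 0, M.1 i 1)) rfl
      map_add' := fun f g => by
        ext1 i
        refine Finsupp.ext fun x => rfl
      map_smul' := fun M f => by
        ext1 i
        refine Finsupp.ext fun x => ?_
        rw [smul_apply]
        change ((M.1 * (f x).1) i 0, (M.1 * (f x).1) i 1) =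
          M.1 i 0 • ((f x).1 0 0, (f x).1 0 1) + M.1 i 1 • ((f x).1 1 0, (f x).1 1 1)
        simp [Matrix.mul_apply] }
  have hi : Function.Injective i := by
    intro f g h
    ext x a b
    have := DFunLike.congr_fun (congr_fun h a) x
    fin_cases b
    · exact congr_arg Prod.fst this
    · exact congr_arg Prod.snd this
  have := projective_submodule_of_globalDimension_le_one hB (lowerPart (K.map i))
  exact hasProjectiveDimensionLE_of_linearEquiv (Submodule.equivMapOfInjective i hi K).symm 1
    (hasProjectiveDimensionLE_one_submodule hmax)

/-! ### Lower bound: the conductor order is not hereditary -/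

theorem not_globalDimension_le_one (hcond : ∀ y : B, (∀ b, b * y ∈ S) → y ∈ C)
    (hidem : C * C ≠ C) : ¬ globalDimension (conductorOrder S C hC) ≤ 1 := by
  intro h
  let L : Submodule (conductorOrder S C hC) (secondColumn S C hC) :=
    { carrier := {w | w.1 1 ∈ C}
      add_mem' := fun h1 h2 => add_mem (S := Ideal B) h1 h2
      zero_mem' := C.zero_mem
      smul_mem' := fun X w hw => by
        change (X • w.1) 1 ∈ C
        rw [smul_apply]
        exact add_mem (C.mul_mem_left _ (mem_secondColumn.1 w.2)) (C.mul_mem_left _ hw) }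
  have hL : Module.Projective (conductorOrder S C hC) L :=
    projective_submodule_of_globalDimension_le_one h L
  obtain ⟨s, hs⟩ := Module.projective_def.1 hL
  have hmem : ∀ v w : B, v ∈ C → ![v, w] ∈ secondColumn S C hC := fun v w hv => by
    simpa [mem_secondColumn] using hv
  let ℓ (v w : C) : L := ⟨⟨![v.1, w.1], hmem v.1 w.1 v.2⟩, w.2⟩
  have hℓ : ∀ (v w : C) (p q r : B) (hp : p ∈ S) (t : B) (ht : t ∈ C),
      (mk p hp t ht q r : conductorOrder S C hC) • ℓ v w =
        ℓ (p • v + t • w) (q • v + r • w) := fun v w p q r hp t ht =>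
    Subtype.ext (Subtype.ext (mk_smul p hp t ht q r v.1 w.1))
  -- The column `(0, b)` is a matrix unit times `(b, 0)`, so the second row of `φ (0, b)` is a first
  -- row and lies in `(S, C)`. Replacing `c` by `b • c` multiplies the `S`-entry by an arbitrary
  -- `b`, so that entry lies in the conductor.
  have key : ∀ (c : C) (φ : L →ₗ[conductorOrder S C hC] conductorOrder S C hC),
      (φ (ℓ 0 c)).1 1 0 ∈ C ∧ (φ (ℓ 0 c)).1 1 1 ∈ C := by
    intro c φ
    have hrow : ∀ b : C, (φ (ℓ 0 b)).1 1 0 ∈ S ∧ (φ (ℓ 0 b)).1 1 1 ∈ C := by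
      intro b
      have h1 := hℓ b 0 0 1 0 S.zero_mem 0 C.zero_mem
      simp only [zero_smul, one_smul, add_zero] at h1
      have h2 : ∀ j, (φ (ℓ 0 b)).1 1 j = (φ (ℓ b 0)).1 0 j := by
        intro j
        rw [← h1, map_smul]
        simp [mk, Matrix.mul_apply]
      rw [h2, h2]
      exact (φ (ℓ b 0)).2
    refine ⟨hcond _ fun b => ?_, (hrow c).2⟩
    have h1 := hℓ 0 c 0 0 b S.zero_mem 0 C.zero_mem
    simp only [zero_smul, zero_add] at h1
    have h2 : (φ (ℓ 0 (b • c))).1 1 0 = b * (φ (ℓ 0 c)).1 1 0 := by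
      rw [← h1, map_smul]
      simp [mk, Matrix.mul_apply]
    rw [← h2]
    exact (hrow _).1
  refine hidem (le_antisymm Ideal.mul_le_left fun c hc => ?_)
  -- Expanding `(0, c)` through the section `s` writes `c` as a sum of products of two elements of
  -- `C`.
  have h1 : ((Finsupp.linearCombination (conductorOrder S C hC) id
      (s (ℓ 0 ⟨c, hc⟩)) : L) : secondColumn S C hC).1 1 = c := by
    rw [hs]; rfl
  rw [← h1, Finsupp.linearCombination_apply, Finsupp.sum, Submodule.coe_sum, Submodule.coe_sum,
    Finset.sum_apply]
  refine sum_mem fun p _ => ?_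
  have h2 := key ⟨c, hc⟩ (Finsupp.lapply p ∘ₗ s)
  change (s (ℓ 0 ⟨c, hc⟩) p • p.1.1) 1 ∈ C * C
  rw [smul_apply]
  exact add_mem (Ideal.mul_mem_mul h2.1 (mem_secondColumn.1 p.1.2)) (Ideal.mul_mem_mul h2.2 p.2)

theorem globalDimension_eq_two (hmax : (C.comap S.subtype).IsMaximal)
    (hB : globalDimension B ≤ 1) (hcond : ∀ y : B, (∀ b, b * y ∈ S) → y ∈ C)
    (hidem : C * C ≠ C) : globalDimension (conductorOrder S C hC) = 2 := by
  refine le_antisymm (globalDimension_le_two hmax hB) ?_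
  have h := not_globalDimension_le_one (hC := hC) hcond hidem
  rw [show (1 : WithBot ℕ∞) = ((1 : ℕ) : WithBot ℕ∞) by rfl, globalDimension_le_iff,
    not_forall] at h
  obtain ⟨N, hN⟩ := h
  have h2 := (projectiveDimension_ge_iff N 2).2 hN
  exact h2.trans (le_iSup (fun N : ModuleCat.{u} (conductorOrder S C hC) =>
    projectiveDimension N) N)

end conductorOrder

/-! ### Integrally closed rings: invertible ideals and regularity -/

open scoped nonZeroDivisors

section IntegrallyClosed

variable {B : Type u} [CommRing B] (Q : Type u) [CommRing Q] [Algebra B Q]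

/-- Cayley–Hamilton for multiplication by `q` on `N`; the unit `u` in `N` replaces faithfulness,
since `p(q) * u = 0` gives `p(q) = 0`. -/
theorem isIntegral_of_mul_mem_of_isUnit_mem {Q : Type u} [CommRing Q] [Algebra B Q]
    (N : Submodule B Q) (hN : N.FG) {u : Q} (hu : IsUnit u) (huN : u ∈ N) (q : Q)
    (hq : ∀ n ∈ N, q * n ∈ N) : IsIntegral B q := by
  have : Module.Finite B N := Module.Finite.iff_fg.2 hN
  let f : Module.End B N := (LinearMap.mulLeft B q).restrict hq
  obtain ⟨p, hp, hpf⟩ := LinearMap.exists_monic_and_aeval_eq_zero B f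
  refine ⟨p, hp, ?_⟩
  have key : ∀ r : Polynomial B, ((Polynomial.aeval f r ⟨u, huN⟩ : N) : Q) =
      Polynomial.aeval q r * u := by
    intro r
    induction r using Polynomial.induction_on' with
    | add r s hr hs => simp [hr, hs, add_mul]
    | monomial n b =>
      have : ∀ n : ℕ, (((f ^ n) ⟨u, huN⟩ : N) : Q) = q ^ n * u := by
        intro n
        induction n with
        | zero => simp
        | succ n ih =>
          rw [pow_succ', Module.End.mul_apply]
          change q * (((f ^ n) ⟨u, huN⟩ : N) : Q) = _
          rw [ih, pow_succ']; ring
      simp [Polynomial.aeval_monomial, this, Algebra.smul_def, mul_assoc]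
  have h := key p
  rw [hpf] at h
  rw [← Polynomial.aeval_def]
  exact hu.mul_left_eq_zero.1 h.symm

variable [IsFractionRing B Q] [IsNoetherianRing B]

/-- A maximal ideal above `L` is minimal over `(x)`, hence the annihilator of a class `y` in
`B/(x)`; take `q = y/x`. -/
theorem exists_mul_mem_of_ne_top (hdim : ∀ p : Ideal B, p.IsPrime → ∀ x ∈ p, x ∈ B⁰ → p.IsMaximal)
    {L : Ideal B} (hL : L ≠ ⊤) {x : B} (hxL : x ∈ L) (hx : x ∈ B⁰) :
    ∃ q : Q, q ∉ (algebraMap B Q).range ∧ ∀ l ∈ L, q * algebraMap B Q l ∈ (algebraMap B Q).range := by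
  obtain ⟨p, hp, hLp⟩ := Ideal.exists_le_maximal L hL
  have hpp := hp.isPrime
  have hxp : Ideal.span {x} ≤ p := (Ideal.span_singleton_le_iff_mem _).2 (hLp hxL)
  obtain ⟨p', hp', hle⟩ := Ideal.exists_minimalPrimes_le hxp
  have hp'max : p'.IsMaximal := hdim p' hp'.1.1 x (hp'.1.2 (Ideal.mem_span_singleton_self x)) hx
  obtain rfl := hp'max.eq_of_le hp.ne_top hle
  have hass := Module.associatedPrimes.minimalPrimes_annihilator_subset_associatedPrimes B
    (B ⧸ Ideal.span {x}) (by rwa [Ideal.annihilator_quotient])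
  obtain ⟨-, y, hy⟩ := (isAssociatedPrime_iff ..).1 hass
  obtain ⟨y, rfl⟩ := Ideal.Quotient.mk_surjective y
  have hmem : ∀ b : B, b ∈ p' ↔ x ∣ b * y := by
    intro b
    rw [hy, Submodule.mem_colon_singleton, Submodule.mem_bot, ← Ideal.mem_span_singleton,
      ← Ideal.Quotient.eq_zero_iff_mem, map_mul]
    rfl
  have hu := IsLocalization.map_units Q (⟨x, hx⟩ : B⁰)
  obtain ⟨v, hv⟩ := hu
  have hv' : (↑v⁻¹ : Q) * algebraMap B Q x = 1 := by rw [← hv]; simp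
  refine ⟨↑v⁻¹ * algebraMap B Q y, ?_, ?_⟩
  · rintro ⟨b, hb⟩
    apply hp'max.ne_top
    rw [Ideal.eq_top_iff_one, hmem, one_mul]
    refine ⟨b, IsFractionRing.injective B Q ?_⟩
    rw [map_mul, hb, ← mul_assoc, mul_comm (algebraMap B Q x), hv', one_mul]
  · intro l hl
    obtain ⟨c, hc⟩ := (hmem l).1 (hLp hl)
    refine ⟨c, ?_⟩
    rw [mul_assoc, ← map_mul, mul_comm y, hc, map_mul, ← mul_assoc, hv', one_mul]

/-- Noetherian induction: with `q` outside `B` and `qL ⊆ B`, the ideal `L(1 + Bq)` strictly contains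
`L`, since otherwise `qL ⊆ L` would make `q` integral. An inverse of the larger ideal yields one of
`L`. -/
theorem exists_mul_eq_one_of_regular
    (hdim : ∀ p : Ideal B, p.IsPrime → ∀ x ∈ p, x ∈ B⁰ → p.IsMaximal)
    (hint : ∀ q : Q, IsIntegral B q → q ∈ (algebraMap B Q).range)
    (L : Ideal B) (hL : ∃ x ∈ L, x ∈ B⁰) :
    ∃ J : Submodule B Q, IsLocalization.coeSubmodule Q L * J = 1 := by
  induction L using IsNoetherian.induction with
  | hgt L ih =>
  by_cases htop : L = ⊤
  · exact ⟨1, by rw [htop, IsLocalization.coeSubmodule_top, mul_one]⟩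
  obtain ⟨x, hxL, hx⟩ := hL
  obtain ⟨q, hq, hqL⟩ := exists_mul_mem_of_ne_top Q hdim htop hxL hx
  let J₀ : Submodule B Q := 1 ⊔ Submodule.span B {q}
  have hle1 : IsLocalization.coeSubmodule Q L * J₀ ≤ 1 := by
    rw [Submodule.mul_sup, mul_one]
    refine sup_le ?_ ?_
    · rw [← IsLocalization.coeSubmodule_top (R := B) Q]
      exact IsLocalization.coeSubmodule_mono Q le_top
    · rw [Submodule.mul_le]
      rintro m hm n hn
      obtain ⟨l, hl, rfl⟩ := (IsLocalization.mem_coeSubmodule Q L).1 hm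
      obtain ⟨b, rfl⟩ := Submodule.mem_span_singleton.1 hn
      obtain ⟨c, hc⟩ := hqL l hl
      rw [mul_smul_comm, mul_comm, ← hc]
      exact Submodule.smul_mem _ _ (Submodule.mem_one.2 ⟨c, rfl⟩)
  let L' : Ideal B := (IsLocalization.coeSubmodule Q L * J₀).comap (Algebra.linearMap B Q)
  have hL' : IsLocalization.coeSubmodule Q L' = IsLocalization.coeSubmodule Q L * J₀ := by
    refine Submodule.map_comap_eq_of_le ?_
    rwa [Submodule.one_eq_range] at hle1
  have hLL' : L ≤ L' := by
    intro l hl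
    have := Submodule.mul_mem_mul ((IsLocalization.mem_coeSubmodule Q L).2 ⟨l, hl, rfl⟩)
      (le_sup_left (a := (1 : Submodule B Q)) (b := Submodule.span B {q}) (Submodule.one_le.1 le_rfl))
    rwa [mul_one] at this
  have hlt : L < L' := by
    refine lt_of_le_of_ne hLL' fun heq => hq (hint q ?_)
    refine isIntegral_of_mul_mem_of_isUnit_mem (IsLocalization.coeSubmodule Q L)
      ((IsNoetherian.noetherian L).map _) (IsLocalization.map_units Q (⟨x, hx⟩ : B⁰))
      ((IsLocalization.mem_coeSubmodule Q L).2 ⟨x, hxL, rfl⟩) q fun n hn => ?_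
    have := Submodule.mul_mem_mul hn (le_sup_right (a := (1 : Submodule B Q))
      (b := Submodule.span B {q}) (Submodule.mem_span_singleton_self q))
    rw [mul_comm q, heq, hL']
    exact this
  obtain ⟨J, hJ⟩ := ih L' hlt ⟨x, hLL' hxL, hx⟩
  exact ⟨J₀ * J, by rw [← mul_assoc, ← hL', hJ]⟩

/-- Since `B` is reduced, `I + ann I` contains a regular element and is invertible. Writing 1 as a
sum of products `(b + c) * n` with `b ∈ I` and `c ∈ ann I`, the `c` terms kill `I`, leaving a dual
basis for `I`. -/
theorem projective_ideal_of_integrallyClosed [IsReduced B]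
    (hdim : ∀ p : Ideal B, p.IsPrime → ∀ x ∈ p, x ∈ B⁰ → p.IsMaximal)
    (hint : ∀ q : Q, IsIntegral B q → q ∈ (algebraMap B Q).range) (I : Ideal B) :
    Module.Projective B I := by
  have hreg : ∃ x ∈ I ⊔ Module.annihilator B I, x ∈ B⁰ := by
    by_contra! h
    have h1 := Ideal.bot_lt_annihilator_of_disjoint_nonZeroDivisors
      (I := I ⊔ Module.annihilator B I) (Set.disjoint_left.2 h)
    refine h1.ne' (eq_bot_iff.2 fun y hy => ?_)
    have hy' := Module.mem_annihilator.1 hy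
    have hyI : y ∈ Module.annihilator B I := by
      rw [Module.mem_annihilator]
      intro m
      have : y * m.1 = 0 := congr_arg Subtype.val (hy' ⟨m.1, Ideal.mem_sup_left m.2⟩)
      exact Subtype.ext this
    have := congr_arg Subtype.val (hy' ⟨y, Ideal.mem_sup_right hyI⟩)
    exact (IsReduced.eq_zero y ⟨2, by rw [pow_two]; exact this⟩)
  obtain ⟨J, hJ⟩ := exists_mul_eq_one_of_regular Q hdim hint _ hreg
  have key : ∀ z ∈ IsLocalization.coeSubmodule Q (I ⊔ Module.annihilator B I) * J,
      ∃ (F : Type u) (_ : AddCommGroup F) (_ : Module B F) (_ : Module.Projective B F)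
        (α : I →ₗ[B] F) (β : F →ₗ[B] I),
        ∀ y, algebraMap B Q (β (α y)) = z * algebraMap B Q y := by
    intro z hz
    induction hz using Submodule.mul_induction_on' with
    | mem_mul_mem m hm n hn =>
      obtain ⟨l, hl, rfl⟩ := (IsLocalization.mem_coeSubmodule Q _).1 hm
      have hmul : ∀ y : I, ∃ b : B, algebraMap B Q b = n * algebraMap B Q y := by
        intro y
        have := Submodule.mul_mem_mul ((IsLocalization.mem_coeSubmodule Q
          (I ⊔ Module.annihilator B I)).2 ⟨y.1, Ideal.mem_sup_left y.2, rfl⟩) hn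
        rw [hJ, mul_comm] at this
        exact Submodule.mem_one.1 this
      choose φ hφ using hmul
      obtain ⟨b, hb, c, hc, rfl⟩ := Submodule.mem_sup.1 hl
      refine ⟨B, inferInstance, inferInstance, inferInstance,
        { toFun := φ
          map_add' := fun x y => IsFractionRing.injective B Q (by simp [hφ, mul_add])
          map_smul' := fun a x => IsFractionRing.injective B Q (by
            simp [hφ, mul_left_comm]) },
        LinearMap.toSpanSingleton B I ⟨b, hb⟩, fun y => ?_⟩
      have hcy : c * (y : B) = 0 := congr_arg Subtype.val (Module.mem_annihilator.1 hc y)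
      have h2 : algebraMap B Q c * algebraMap B Q y = 0 := by rw [← map_mul, hcy, map_zero]
      simp only [LinearMap.coe_mk, AddHom.coe_mk, LinearMap.toSpanSingleton_apply,
        Submodule.coe_smul, smul_eq_mul, map_mul, hφ, map_add]
      linear_combination (-n) * h2
    | add z _ w _ hz hw =>
      obtain ⟨F, _, _, _, α, β, h⟩ := hz
      obtain ⟨F', _, _, _, α', β', h'⟩ := hw
      refine ⟨F × F', inferInstance, inferInstance, inferInstance, α.prod α', β.coprod β',
        fun y => ?_⟩
      simp [h, h', add_mul]
  obtain ⟨F, _, _, _, α, β, h⟩ := key 1 (hJ ▸ (Submodule.one_le.1 le_rfl))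
  refine Module.Projective.of_split α β (LinearMap.ext fun y => Subtype.ext ?_)
  exact IsFractionRing.injective B Q (by simpa using h y)

theorem globalDimension_le_one_of_integrallyClosed [IsReduced B]
    (hdim : ∀ p : Ideal B, p.IsPrime → ∀ x ∈ p, x ∈ B⁰ → p.IsMaximal)
    (hint : ∀ q : Q, IsIntegral B q → q ∈ (algebraMap B Q).range) : globalDimension B ≤ 1 :=
  globalDimension_le_one_of_projective_ideals (projective_ideal_of_integrallyClosed Q hdim hint)

end IntegrallyClosed

theorem one_le_globalDimension {B : Type u} [CommRing B] {x : B} (hx : x ∈ nonZeroDivisors B)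
    (hu : ¬ IsUnit x) : 1 ≤ globalDimension B := by
  have h : ¬ HasProjectiveDimensionLT (ModuleCat.of B (B ⧸ Ideal.span {x})) 1 := by
    rw [← projective_iff_hasProjectiveDimensionLT_one, ← IsProjective.iff_projective]
    intro h
    obtain ⟨s, hs⟩ := Module.projective_lifting_property (Ideal.span {x}).mkQ LinearMap.id
      (Submodule.mkQ_surjective _)
    have h1 : x * s (Ideal.Quotient.mk _ 1) = 0 := by
      rw [← smul_eq_mul, ← map_smul]
      convert map_zero s
      change Ideal.Quotient.mk _ (x * 1) = 0
      rw [mul_one, Ideal.Quotient.eq_zero_iff_mem]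
      exact Ideal.mem_span_singleton_self x
    have h2 : s (Ideal.Quotient.mk _ 1) = 0 := (mem_nonZeroDivisors_iff.1 hx).1 _ h1
    have h3 := LinearMap.congr_fun hs (Ideal.Quotient.mk _ 1)
    rw [LinearMap.comp_apply, h2, map_zero] at h3
    have h4 := Ideal.Quotient.eq_zero_iff_mem.1 h3.symm
    exact hu (isUnit_of_dvd_one (Ideal.mem_span_singleton.1 h4))
  exact ((projectiveDimension_ge_iff _ 1).2 h).trans
    (le_iSup (fun N : ModuleCat.{u} B => projectiveDimension N) _)

/-- The maximal ideal is invertible. Over a local ring some single product `l * j` is a unit, so `l`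
generates the maximal ideal. -/
theorem isRegularLocalRing_of_integrallyClosed {R : Type u} [CommRing R] [IsLocalRing R]
    [IsNoetherianRing R] (Q : Type u) [CommRing Q] [Algebra R Q] [IsFractionRing R Q]
    (hR : 1 ≤ ringKrullDim R)
    (hdim : ∀ p : Ideal R, p.IsPrime → ∀ x ∈ p, x ∈ R⁰ → p.IsMaximal)
    (hint : ∀ q : Q, IsIntegral R q → q ∈ (algebraMap R Q).range)
    {x : R} (hx : x ∈ R⁰) (hxm : x ∈ IsLocalRing.maximalIdeal R) : IsRegularLocalRing R := by
  obtain ⟨J, hJ⟩ := exists_mul_eq_one_of_regular Q hdim hint (IsLocalRing.maximalIdeal R)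
    ⟨x, hxm, hx⟩
  obtain ⟨l, hl, j, hj, u, hu, hlj⟩ : ∃ l ∈ IsLocalRing.maximalIdeal R, ∃ j ∈ J, ∃ u : R,
      IsUnit u ∧ algebraMap R Q l * j = algebraMap R Q u := by
    by_contra! hcon
    have hle : IsLocalization.coeSubmodule Q (IsLocalRing.maximalIdeal R) * J ≤
        IsLocalization.coeSubmodule Q (IsLocalRing.maximalIdeal R) := by
      rw [Submodule.mul_le]
      intro m hm j hj
      have h1 := Submodule.mul_mem_mul hm hj
      rw [hJ] at h1
      obtain ⟨u, hu⟩ := Submodule.mem_one.1 h1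
      obtain ⟨l, hl, rfl⟩ := (IsLocalization.mem_coeSubmodule Q _).1 hm
      refine (IsLocalization.mem_coeSubmodule Q _).2 ⟨u, ?_, hu⟩
      by_contra hu'
      exact hcon l hl j hj u (not_not.1 hu') hu.symm
    rw [hJ] at hle
    obtain ⟨y, hy, hy1⟩ := (IsLocalization.mem_coeSubmodule Q _).1 (hle (Submodule.one_le.1 le_rfl))
    rw [← map_one (algebraMap R Q)] at hy1
    rw [IsFractionRing.injective R Q hy1] at hy
    exact (Ideal.ne_top_iff_one _).1 (IsLocalRing.maximalIdeal.isMaximal R).ne_top hy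
  have hspan : IsLocalRing.maximalIdeal R = Ideal.span {l} := by
    refine le_antisymm (fun y hy => ?_) ((Ideal.span_singleton_le_iff_mem _).2 hl)
    have h1 := Submodule.mul_mem_mul
      ((IsLocalization.mem_coeSubmodule Q (IsLocalRing.maximalIdeal R)).2 ⟨y, hy, rfl⟩) hj
    rw [hJ] at h1
    obtain ⟨v, hv⟩ := Submodule.mem_one.1 h1
    rw [Ideal.mem_span_singleton]
    have h2 : u * y = l * v := by
      apply IsFractionRing.injective R Q
      rw [map_mul, map_mul, hv, ← hlj]
      ring
    exact (hu.dvd_mul_left).1 ⟨v, h2⟩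
  refine IsRegularLocalRing.of_spanFinrank_maximalIdeal_le R (le_trans ?_ hR)
  have : (IsLocalRing.maximalIdeal R).spanFinrank ≤ 1 := by
    rw [hspan]
    exact (Submodule.spanFinrank_span_le_ncard_of_finite (Set.finite_singleton l)).trans (by simp)
  exact_mod_cast this

/-! ### Complete rings and lengths: tools for finiteness -/

theorem IsPrecomplete.pi_fintype {R ι : Type*} [CommRing R] [Fintype ι] (I : Ideal R)
    [hI : IsPrecomplete I R] : IsPrecomplete I (ι → R) := by
  classical
  refine ⟨fun f hf => ?_⟩
  have h1 : ∀ i, ∃ L : R, ∀ n, f n i ≡ L [SMOD (I ^ n • ⊤ : Submodule R R)] := by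
    intro i
    refine hI.prec (fun {m n} hmn => ?_)
    have := (hf hmn).map (LinearMap.proj i : (ι → R) →ₗ[R] R)
    refine this.mono ?_
    rw [Submodule.map_smul'']
    exact smul_mono_right _ le_top
  choose L hL using h1
  refine ⟨L, fun n => ?_⟩
  rw [SModEq.sub_mem, pi_eq_sum_univ (f n - L)]
  refine sum_mem fun i _ => Submodule.smul_mem_smul ?_ trivial
  have := SModEq.sub_mem.1 (hL i n)
  simpa using this

theorem Module.Finite.of_isHausdorff_of_finite_quotient {R M : Type*} [CommRing R] [AddCommGroup M]
    [Module R M] (I : Ideal R) [IsPrecomplete I R] [IsHausdorff I M]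
    [Module.Finite R (M ⧸ (I • ⊤ : Submodule R M))] : Module.Finite R M := by
  obtain ⟨n, f, hf⟩ := Module.Finite.exists_fin' R (M ⧸ (I • ⊤ : Submodule R M))
  obtain ⟨g, hg⟩ := Module.projective_lifting_property (I • ⊤ : Submodule R M).mkQ f
    (Submodule.mkQ_surjective _)
  have := IsPrecomplete.pi_fintype (ι := Fin n) I
  refine Module.Finite.of_surjective g (surjective_of_mkQ_comp_surjective (I := I) ?_)
  rwa [hg]

section Length

variable {R : Type*} [CommRing R]

/-- Compute the length of `M/f(I)` through `I` and through `f(M)`, then cancel the finite length of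
`M/I ≅ f(M)/f(I)`. -/
theorem Module.length_quotient_map_eq {M : Type*} [AddCommGroup M] [Module R M] (f : M →ₗ[R] M)
    (hf : Function.Injective f) (I : Submodule R M) (hI : I.map f ≤ I)
    (hfin : Module.length R (M ⧸ I) ≠ ⊤) :
    Module.length R (I ⧸ (I.map f).comap I.subtype) =
      Module.length R (M ⧸ LinearMap.range f) := by
  have h1 := Module.length_eq_add_of_exact
    (Submodule.mapQ ((I.map f).comap I.subtype) (I.map f) I.subtype le_rfl)
    (Submodule.factor hI) ?_ (Submodule.factor_surjective hI) ?_
  · have h2 := Module.length_eq_add_of_exact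
      (Submodule.mapQ I (I.map f) f (Submodule.le_comap_map _ _))
      (Submodule.factor (LinearMap.map_le_range (p := I) (f := f))) ?_
      (Submodule.factor_surjective _) ?_
    · rw [h1, add_comm] at h2
      exact ENat.add_right_injective_of_ne_top hfin h2
    · rw [← LinearMap.ker_eq_bot, Submodule.ker_mapQ, Submodule.comap_map_eq_of_injective hf]
      simp
    · rw [LinearMap.exact_iff]
      ext z
      obtain ⟨z, rfl⟩ := Submodule.mkQ_surjective _ z
      rw [LinearMap.mem_ker]
      constructor
      · intro hz
        obtain ⟨w, rfl⟩ := (Submodule.Quotient.mk_eq_zero _).1 hz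
        exact ⟨Submodule.Quotient.mk w, rfl⟩
      · rintro ⟨w, hw⟩
        obtain ⟨w, rfl⟩ := Submodule.mkQ_surjective _ w
        rw [← hw]
        exact (Submodule.Quotient.mk_eq_zero _).2 ⟨w, rfl⟩
  · rw [← LinearMap.ker_eq_bot, Submodule.ker_mapQ]
    exact Submodule.mkQ_map_self _
  · rw [LinearMap.exact_iff]
    ext z
    obtain ⟨z, rfl⟩ := Submodule.mkQ_surjective _ z
    rw [LinearMap.mem_ker]
    constructor
    · intro hz
      exact ⟨Submodule.Quotient.mk ⟨z, (Submodule.Quotient.mk_eq_zero _).1 hz⟩, rfl⟩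
    · rintro ⟨w, hw⟩
      obtain ⟨w, rfl⟩ := Submodule.mkQ_surjective _ w
      rw [← hw]
      exact (Submodule.Quotient.mk_eq_zero _).2 w.2

theorem Module.finite_of_length_le {V : Type*} [AddCommGroup V] [Module R V] (n : ℕ)
    (h : ∀ P : Submodule R V, P.FG → Module.length R P ≤ n) : Module.Finite R V := by
  classical
  obtain ⟨k, ⟨P, hP, hPk⟩, hmax⟩ : ∃ k, (∃ P : Submodule R V, P.FG ∧ Module.length R P = (k : ℕ)) ∧
      ∀ m, (∃ P : Submodule R V, P.FG ∧ Module.length R P = (m : ℕ)) → m ≤ k := by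
    have hb : ∀ m, (∃ P : Submodule R V, P.FG ∧ Module.length R P = (m : ℕ)) → m ≤ n := by
      rintro m ⟨P, hP, hm⟩
      have := h P hP
      rw [hm] at this
      exact_mod_cast this
    exact ⟨_, Nat.findGreatest_spec (P := fun m => ∃ P : Submodule R V, P.FG ∧
      Module.length R P = (m : ℕ)) (Nat.zero_le n) ⟨⊥, Submodule.fg_bot, by simp⟩,
      fun m hm => Nat.le_findGreatest (hb m hm) hm⟩
  suffices P = ⊤ from ⟨this ▸ hP⟩
  by_contra hne
  obtain ⟨y, hy⟩ : ∃ y, y ∉ P := by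
    by_contra! hcon
    exact hne (eq_top_iff.2 fun y _ => hcon y)
  set P' := P ⊔ Submodule.span R {y} with hP'
  have hP'fg : P'.FG := hP.sup (Submodule.fg_span_singleton y)
  have hle : P ≤ P' := le_sup_left
  have hfin : Module.length R P' ≠ ⊤ := ((h P' hP'fg).trans_lt (ENat.natCast_lt_top n)).ne
  obtain ⟨_, _⟩ := isFiniteLength_iff_isNoetherian_isArtinian.1
    (Module.length_ne_top_iff.1 hfin)
  have hlt : Module.length R (P.submoduleOf P') < Module.length R P' := by
    refine Submodule.length_lt fun htop => hy ?_
    exact Submodule.submoduleOf_eq_top.1 htop (le_sup_right (a := P)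
      (Submodule.mem_span_singleton_self y))
  rw [(Submodule.submoduleOfEquivOfLe hle).length_eq, hPk] at hlt
  obtain ⟨m, hm⟩ := ENat.ne_top_iff_exists.1 hfin
  rw [← hm] at hlt
  have h1 := hmax m ⟨P', hP'fg, hm.symm⟩
  have h2 : k < m := by exact_mod_cast hlt
  omega

theorem isArtinianRing_quotient_span_singleton [IsNoetherianRing R] (hR : ringKrullDim R ≤ 1)
    {d : R} (hd : d ∈ R⁰) : IsArtinianRing (R ⧸ Ideal.span {d}) := by
  rw [isArtinianRing_iff_isNoetherianRing_krullDimLE_zero]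
  refine ⟨inferInstance, ?_⟩
  have h := (ringKrullDim_quotient_succ_le_of_nonZeroDivisor hd).trans hR
  rw [Ring.KrullDimLE, Order.krullDimLE_iff]
  change ringKrullDim _ ≤ _
  exact ENat.WithBot.add_le_add_one_right_iff.1 (by simpa using h)

theorem length_quotient_ne_top_of_regular [IsNoetherianRing R] (hR : ringKrullDim R ≤ 1)
    (I : Ideal R) {d : R} (hdI : d ∈ I) (hd : d ∈ R⁰) : Module.length R (R ⧸ I) ≠ ⊤ := by
  have := isArtinianRing_quotient_span_singleton hR hd
  have h1 : IsArtinian R (R ⧸ Ideal.span {d}) :=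
    isArtinian_of_surjective_algebraMap (R := R ⧸ Ideal.span {d}) Ideal.Quotient.mk_surjective
  have h2 : Module.length R (R ⧸ Ideal.span {d}) ≠ ⊤ := Module.length_ne_top
  have h3 := Module.length_le_of_surjective
    (Submodule.factor ((Ideal.span_singleton_le_iff_mem _).2 hdI) :
      (R ⧸ Ideal.span {d}) →ₗ[R] (R ⧸ I)) (Submodule.factor_surjective _)
  exact (h3.trans_lt (lt_top_iff_ne_top.2 h2)).ne

end Length

/-! ### Krull–Akizuki bound for submodules of the total fraction ring -/

section KrullAkizuki

variable {R : Type u} [CommRing R] [IsNoetherianRing R] (Q : Type u) [CommRing Q] [Algebra R Q]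
  [IsFractionRing R Q]

variable {Q} in
-- A common denominator `d` identifies `N` with an ideal of `R`. As `1 ∈ N`, this ideal contains
-- `d`, so it has finite colength and `Module.length_quotient_map_eq` applies to multiplication by
-- `x`.
theorem length_quotient_smul_le_of_fg (hR : ringKrullDim R ≤ 1) {x : R} (hx : x ∈ R⁰)
    (N : Submodule R Q) (hN : N.FG) (h1 : 1 ∈ N) :
    Module.length R (N ⧸ LinearMap.range (LinearMap.lsmul R N x)) ≤
      Module.length R (R ⧸ Ideal.span {x}) := by
  classical
  obtain ⟨s, rfl⟩ := hN
  obtain ⟨d, hd⟩ := IsLocalization.exist_integer_multiples_of_finset R⁰ s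
  have hd' : ∀ n ∈ Submodule.span R (s : Set Q), IsLocalization.IsInteger R ((d : R) • n) := by
    intro n hn
    induction hn using Submodule.span_induction with
    | mem n hn => exact hd n hn
    | zero => rw [smul_zero]; exact IsLocalization.isInteger_zero
    | add a b _ _ ha hb => rw [smul_add]; exact IsLocalization.isInteger_add ha hb
    | smul r a _ ha => rw [smul_comm]; exact IsLocalization.isInteger_smul ha
  set N := Submodule.span R (s : Set Q)
  have hinj := IsFractionRing.injective R Q
  choose φ hφ using hd'
  let g : N →ₗ[R] R :=
    { toFun := fun n => φ n.1 n.2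
      map_add' := fun a b => hinj (by simp [hφ])
      map_smul' := fun r a => hinj (by
        simp only [Submodule.coe_smul, RingHom.id_apply, smul_eq_mul, map_mul, hφ]
        rw [smul_comm, Algebra.smul_def r]) }
  have hg : ∀ n : N, algebraMap R Q (g n) = (d : R) • (n : Q) := fun n => hφ n.1 n.2
  have hginj : Function.Injective g := by
    intro a b hab
    have h2 : algebraMap R Q d * a = algebraMap R Q d * b := by
      rw [← Algebra.smul_def, ← Algebra.smul_def, ← hg, ← hg, hab]
    exact Subtype.ext ((IsLocalization.map_units Q d).mul_left_cancel h2)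
  let f : R →ₗ[R] R := LinearMap.lsmul R R x
  have hf : Function.Injective f := fun a b hab =>
    (mul_cancel_left_mem_nonZeroDivisors hx).1 (show x * a = x * b from hab)
  have hle : (LinearMap.range g).map f ≤ LinearMap.range g := by
    rintro _ ⟨_, ⟨n, rfl⟩, rfl⟩
    exact ⟨x • n, map_smul g x n⟩
  have hdI : (d : R) ∈ LinearMap.range g := by
    refine ⟨⟨1, h1⟩, hinj ?_⟩
    rw [hg, Algebra.smul_def, mul_one]
  have key := Module.length_quotient_map_eq f hf (LinearMap.range g) hle
    (length_quotient_ne_top_of_regular hR _ hdI d.2)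
  have hrange : LinearMap.range f = Ideal.span {x} := by
    ext r
    rw [Ideal.mem_span_singleton, LinearMap.mem_range]
    exact ⟨fun ⟨a, ha⟩ => ⟨a, ha.symm⟩, fun ⟨a, ha⟩ => ⟨a, ha.symm⟩⟩
  have e := Submodule.Quotient.equiv (LinearMap.range (LinearMap.lsmul R N x))
    (((LinearMap.range g).map f).comap (LinearMap.range g).subtype)
    (LinearEquiv.ofInjective g hginj) (by
      ext z
      constructor
      · rintro ⟨_, ⟨n, rfl⟩, rfl⟩
        exact ⟨g n, ⟨n, rfl⟩, (map_smul g x n).symm⟩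
      · rintro ⟨_, ⟨n, rfl⟩, hn⟩
        refine ⟨x • n, ⟨n, rfl⟩, Subtype.ext ?_⟩
        exact (map_smul g x n).trans hn)
  rw [e.length_eq, key, hrange]

variable {Q} in
theorem finite_quotient_smul_of_one_mem (hR : ringKrullDim R ≤ 1) {x : R} (hx : x ∈ R⁰)
    (N : Submodule R Q) (h1 : 1 ∈ N) :
    Module.Finite R (N ⧸ LinearMap.range (LinearMap.lsmul R N x)) := by
  classical
  have hxl : Module.length R (R ⧸ Ideal.span {x}) ≠ ⊤ :=
    length_quotient_ne_top_of_regular hR _ (Ideal.mem_span_singleton_self x) hx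
  obtain ⟨n, hn⟩ := ENat.ne_top_iff_exists.1 hxl
  refine Module.finite_of_length_le n ?_
  rintro _ ⟨s, rfl⟩
  rw [hn]
  choose l hl using (Submodule.mkQ_surjective (LinearMap.range (LinearMap.lsmul R N x)))
  let t : Finset Q := insert 1 (s.image fun v => (l v : Q))
  let M : Submodule R Q := Submodule.span R t
  have hMN : M ≤ N := by
    refine Submodule.span_le.2 fun z hz => ?_
    rcases Finset.mem_insert.1 hz with rfl | hz
    · exact h1
    · obtain ⟨v, -, rfl⟩ := Finset.mem_image.1 hz
      exact (l v).2
  have hM := length_quotient_smul_le_of_fg hR hx M ⟨t, rfl⟩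
    (Submodule.subset_span (Finset.mem_insert_self _ _))
  refine le_trans ?_ hM
  let p : (M ⧸ LinearMap.range (LinearMap.lsmul R M x)) →ₗ[R]
      (N ⧸ LinearMap.range (LinearMap.lsmul R N x)) :=
    Submodule.mapQ _ _ (Submodule.inclusion hMN) (by
      rintro _ ⟨m, rfl⟩
      exact ⟨Submodule.inclusion hMN m, rfl⟩)
  have hle : Submodule.span R (s : Set (N ⧸ LinearMap.range (LinearMap.lsmul R N x))) ≤
      LinearMap.range p := by
    refine Submodule.span_le.2 fun v hv => ?_
    refine ⟨Submodule.Quotient.mk ⟨l v, Submodule.subset_span (Finset.mem_insert_of_mem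
      (Finset.mem_image_of_mem _ hv))⟩, ?_⟩
    exact hl v
  exact (Module.length_le_of_injective _ (Submodule.inclusion_injective hle)).trans
    (Module.length_le_of_surjective _ p.surjective_rangeRestrict)

end KrullAkizuki

/-! ### Separatedness and finiteness of the normalization -/

section Separated

theorem Ring.KrullDimLE.of_ringKrullDim_eq_one {R : Type u} [CommRing R]
    (hR : ringKrullDim R = 1) : Ring.KrullDimLE 1 R := by
  rw [Ring.KrullDimLE, Order.krullDimLE_iff]
  exact hR.le

theorem exists_pow_mem_sup_span {R : Type u} [CommRing R] [IsLocalRing R]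
    [Ring.KrullDimLE 1 R] {P : Ideal R} [P.IsPrime] {x : R}
    (hxm : x ∈ IsLocalRing.maximalIdeal R) {c : R} (hc : c ∉ P) :
    ∃ n : ℕ, x ^ n ∈ P ⊔ Ideal.span {c} := by
  have : x ∈ (P ⊔ Ideal.span {c}).radical := by
    rw [Ideal.radical_eq_sInf, Ideal.mem_sInf]
    rintro p ⟨hle, hp⟩
    have hPp : P < p := lt_of_le_of_ne (le_sup_left.trans hle) (by
      rintro rfl
      exact hc (hle (Ideal.mem_sup_right (Ideal.mem_span_singleton_self c))))
    rcases Ring.krullDimLE_one_iff.1 ‹_› p hp with h | h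
    · exact absurd (h.2 ⟨‹_›, bot_le⟩ hPp.le) hPp.not_ge
    · rwa [IsLocalRing.eq_maximalIdeal h]
  exact this

variable {R : Type u} [CommRing R] [IsLocalRing R] [IsReduced R]
  {Q : Type u} [CommRing Q] [Algebra R Q] [IsFractionRing R Q]

/-- If `a ≠ 0`, some minimal prime `P` misses `a`. For a fraction `b/c` over `R/P`, some `x ^ n` is
a multiple of `c` modulo `P`, so `a * (b/c)` is integral. Then the whole fraction field is integral
over `R/P`, so `P` is maximal and contains the regular element `x`, which is impossible. -/
theorem eq_zero_of_forall_eq_pow_mul_integral (hR : ringKrullDim R = 1) {x : R} (hx : x ∈ R⁰)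
    (hxm : x ∈ IsLocalRing.maximalIdeal R) (a : R)
    (h : ∀ n : ℕ, ∃ z : Q, IsIntegral R z ∧ algebraMap R Q a = algebraMap R Q x ^ n * z) :
    a = 0 := by
  have := Ring.KrullDimLE.of_ringKrullDim_eq_one hR
  by_contra ha
  obtain ⟨P, hPmin, haP⟩ : ∃ P ∈ minimalPrimes R, a ∉ P := by
    by_contra! hcon
    have : a ∈ nilradical R := by
      rw [nilradical, ← Ideal.sInf_minimalPrimes, Ideal.mem_sInf]
      exact fun {P} hP => hcon P hP
    rw [nilradical_eq_zero] at this
    exact ha this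
  have hP : P.IsPrime := hPmin.1.1
  have hdisj := Ideal.disjoint_nonZeroDivisors_of_mem_minimalPrimes hPmin
  have hxP : x ∉ P := fun hxP => Set.disjoint_left.1 hdisj hxP hx
  let ψ : R →+* (FractionRing (R ⧸ P)) := (algebraMap (R ⧸ P) (FractionRing (R ⧸ P))).comp (Ideal.Quotient.mk P)
  have hψ : ∀ r : R, ψ r = 0 ↔ r ∈ P := by
    intro r
    rw [RingHom.comp_apply, map_eq_zero_iff _ (IsFractionRing.injective (R ⧸ P) _),
      Ideal.Quotient.eq_zero_iff_mem]
  let φ : Q →+* (FractionRing (R ⧸ P)) := IsLocalization.lift (M := R⁰) (g := ψ) fun y =>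
    (isUnit_iff_ne_zero.2 fun h0 => Set.disjoint_left.1 hdisj ((hψ _).1 h0) y.2)
  have hφ : ∀ r : R, φ (algebraMap R Q r) = ψ r := fun r => IsLocalization.lift_eq _ r
  have hφint : ∀ z : Q, IsIntegral R z → IsIntegral (R ⧸ P) (φ z) := by
    rintro z ⟨p, hp, hpz⟩
    refine ⟨p.map (Ideal.Quotient.mk P), hp.map _, ?_⟩
    rw [Polynomial.eval₂_map]
    have h1 := congr_arg φ hpz
    rw [map_zero, Polynomial.hom_eval₂] at h1
    rwa [show φ.comp (algebraMap R Q) = ψ from RingHom.ext hφ] at h1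
  have hall : ∀ q : (FractionRing (R ⧸ P)), IsIntegral (R ⧸ P) (ψ a * q) := by
    intro q
    obtain ⟨b, c, hc, rfl⟩ := IsFractionRing.div_surjective (A := (R ⧸ P)) q
    obtain ⟨b, rfl⟩ := Ideal.Quotient.mk_surjective b
    obtain ⟨c, rfl⟩ := Ideal.Quotient.mk_surjective c
    have hcP : c ∉ P := fun hcP => nonZeroDivisors.ne_zero hc (Ideal.Quotient.eq_zero_iff_mem.2 hcP)
    obtain ⟨n, hn⟩ := exists_pow_mem_sup_span hxm hcP
    obtain ⟨p, hp, y, hy, hpy⟩ := Submodule.mem_sup.1 hn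
    obtain ⟨u, rfl⟩ := Ideal.mem_span_singleton'.1 hy
    obtain ⟨z, hz, haz⟩ := h n
    have h1 : ψ x ^ n = ψ u * ψ c := by
      rw [← map_pow, ← hpy, map_add, (hψ p).2 hp, zero_add, map_mul]
    have h2 : ψ a = ψ x ^ n * φ z := by
      rw [← hφ, haz, map_mul, map_pow, hφ]
    have h3 : ψ c ≠ 0 := fun h0 => hcP ((hψ c).1 h0)
    have h4 : ψ a * (ψ b / ψ c) = φ z * (ψ u * ψ b) := by
      rw [h2, h1]
      field_simp
    change IsIntegral (R ⧸ P) (ψ a * (ψ b / ψ c))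
    rw [h4]
    refine (hφint z hz).mul ?_
    rw [← map_mul]
    exact isIntegral_algebraMap
  have hψa : ψ a ≠ 0 := fun h0 => haP ((hψ a).1 h0)
  have hint : Algebra.IsIntegral (R ⧸ P) (FractionRing (R ⧸ P)) := ⟨fun q => by
    have := hall (q / ψ a)
    rwa [mul_div_cancel₀ _ hψa] at this⟩
  have hfield : IsField (R ⧸ P) := isField_of_isIntegral_of_isField
    (IsFractionRing.injective (R ⧸ P) _) (Field.toIsField (FractionRing (R ⧸ P)))
  have hPmax := Ideal.Quotient.maximal_of_isField P hfield
  rw [IsLocalRing.eq_maximalIdeal hPmax] at hxP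
  exact hxP hxm

end Separated

section Finiteness

variable {R : Type u} [CommRing R] [IsLocalRing R] [IsNoetherianRing R]

theorem exists_maximalIdeal_pow_le_span (hR : ringKrullDim R = 1) {x : R} (hx : x ∈ R⁰) :
    ∃ k : ℕ, IsLocalRing.maximalIdeal R ^ k ≤ Ideal.span {x} := by
  have := isArtinianRing_quotient_span_singleton hR.le hx
  refine Ideal.exists_pow_le_of_le_radical_of_fg ?_ (IsNoetherian.noetherian _)
  rw [Ideal.radical_eq_sInf]
  refine le_sInf fun p hp => ?_
  have hpp := hp.2
  have : (p.map (Ideal.Quotient.mk (Ideal.span {x}))).IsMaximal := by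
    have := Ideal.map_isPrime_of_surjective (I := p)
      (Ideal.Quotient.mk_surjective (I := Ideal.span {x})) (by rw [Ideal.mk_ker]; exact hp.1)
    infer_instance
  have hmax : p.IsMaximal := by
    have h1 := Ideal.comap_isMaximal_of_surjective (Ideal.Quotient.mk (Ideal.span {x}))
      Ideal.Quotient.mk_surjective (K := p.map (Ideal.Quotient.mk (Ideal.span {x})))
    rwa [Ideal.comap_map_of_surjective _ Ideal.Quotient.mk_surjective, ← RingHom.ker_eq_comap_bot,
      Ideal.mk_ker, sup_eq_left.2 hp.1] at h1
  exact (IsLocalRing.eq_maximalIdeal hmax).ge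

variable {Q : Type u} [CommRing Q] [Algebra R Q] [IsFractionRing R Q]

theorem finite_integralClosure [IsReduced R] [IsPrecomplete (IsLocalRing.maximalIdeal R) R]
    (hR : ringKrullDim R = 1) {x : R} (hx : x ∈ R⁰) (hxm : x ∈ IsLocalRing.maximalIdeal R) :
    Module.Finite R (integralClosure R Q) := by
  set B := integralClosure R Q
  set 𝔪 := IsLocalRing.maximalIdeal R
  have hfin := finite_quotient_smul_of_one_mem hR.le hx (Subalgebra.toSubmodule B) B.one_mem
  have hle : LinearMap.range (LinearMap.lsmul R B x) ≤ 𝔪 • (⊤ : Submodule R B) := by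
    rintro _ ⟨b, rfl⟩
    exact Submodule.smul_mem_smul hxm trivial
  have : Module.Finite R (B ⧸ (𝔪 • ⊤ : Submodule R B)) :=
    Module.Finite.of_surjective (M := B ⧸ LinearMap.range (LinearMap.lsmul R B x))
      (Submodule.factor hle) (Submodule.factor_surjective hle)
  have hdiv : ∀ (n : ℕ) (b : B), b ∈ ((Ideal.span {x}) ^ n • ⊤ : Submodule R B) →
      ∃ z : B, b = x ^ n • z := by
    intro n b hb
    rw [Ideal.span_singleton_pow, Submodule.ideal_span_singleton_smul] at hb
    obtain ⟨z, -, hz⟩ := hb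
    exact ⟨z, hz.symm⟩
  obtain ⟨k, hk⟩ := exists_maximalIdeal_pow_le_span hR hx
  have : IsHausdorff 𝔪 B := by
    refine ⟨fun y hy => ?_⟩
    have hy' : ∀ n : ℕ, ∃ z : B, y = x ^ n • z := by
      intro n
      refine hdiv n y ?_
      have h1 := SModEq.zero.1 (hy (k * n))
      rw [pow_mul] at h1
      exact Submodule.smul_mono_left (Ideal.pow_right_mono hk n) h1
    -- Clearing the denominator of `y` reduces separatedness to an element `a` of `R`.
    obtain ⟨a, s, hs⟩ := IsLocalization.exists_mk'_eq R⁰ (y : Q)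
    have hay : algebraMap R Q a = algebraMap R Q s * (y : Q) := by
      rw [← hs, IsLocalization.mk'_spec']
    have ha : a = 0 := by
      refine eq_zero_of_forall_eq_pow_mul_integral (Q := Q) hR hx hxm a fun n => ?_
      obtain ⟨z, hz⟩ := hy' n
      refine ⟨algebraMap R Q s * z, isIntegral_algebraMap.mul z.2, ?_⟩
      rw [hay, hz, Subalgebra.coe_smul, Algebra.smul_def, map_pow]
      ring
    rw [ha, map_zero] at hay
    exact Subtype.ext ((IsLocalization.map_units Q s).mul_right_eq_zero.1 hay.symm)
  exact Module.Finite.of_isHausdorff_of_finite_quotient 𝔪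

end Finiteness

/-! ### Depth one and Cohen–Macaulay modules -/

section Depth

variable {R : Type u} [CommRing R] [IsLocalRing R] [IsNoetherianRing R]

open IsLocalRing

theorem exists_ne_zero_residueField_hom {V : Type u} [AddCommGroup V] [Module R V]
    [Nontrivial V] {k : ℕ} (hk : ∀ r ∈ maximalIdeal R ^ k, ∀ v : V, r • v = 0) :
    ∃ f : ResidueField R →ₗ[R] V, f ≠ 0 := by
  obtain ⟨p, hp⟩ := associatedPrimes.nonempty R V
  obtain ⟨hpp, y, hy⟩ := (isAssociatedPrime_iff ..).1 hp
  have hmem : ∀ r, r ∈ p ↔ r • y = 0 := fun r => by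
    rw [hy, Submodule.mem_colon_singleton, Submodule.mem_bot]
  have hle : maximalIdeal R ≤ p :=
    hpp.le_of_pow_le (n := k) fun r hr => (hmem r).2 (hk r hr y)
  let f : (R ⧸ maximalIdeal R) →ₗ[R] V := (maximalIdeal R).liftQ (LinearMap.toSpanSingleton R V y)
    fun r hr => (hmem r).1 (hle hr)
  refine ⟨f, fun h0 => hpp.ne_top ((Ideal.eq_top_iff_one p).2 ((hmem 1).2 ?_))⟩
  exact LinearMap.congr_fun h0 (Ideal.Quotient.mk _ 1)

/-- `Hom(k, M) = 0` since `x` kills `k` and is regular on `M`. The module `M/xM` is nonzero and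
killed by a power of the maximal ideal, so it receives a nonzero map from `k`; vanishing of `Ext¹(k,
M)` would lift this map to `M`. -/
theorem moduleDepth_eq_one (hR : ringKrullDim R = 1) {x : R} (hx : x ∈ R⁰)
    (hxm : x ∈ maximalIdeal R) (M : Type u) [AddCommGroup M] [Module R M] [Module.Finite R M]
    [Nontrivial M] (hxM : ∀ m : M, x • m = 0 → m = 0) : moduleDepth R M = 1 := by
  obtain ⟨k, hk⟩ := exists_maximalIdeal_pow_le_span hR hx
  have hhom : ∀ f : ModuleCat.of R (ResidueField R) ⟶ ModuleCat.of R M, f = 0 := by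
    intro f
    ext z
    apply hxM
    change x • f.hom z = 0
    obtain ⟨r, rfl⟩ := residue_surjective z
    rw [← map_smul, Algebra.smul_def]
    have : algebraMap R (ResidueField R) x = 0 := (residue_eq_zero_iff x).2 hxm
    rw [this, zero_mul, map_zero]
  have h0 : Subsingleton (Abelian.Ext (ModuleCat.of R (ResidueField R)) (ModuleCat.of R M) 0) :=
    ⟨fun a b => Abelian.Ext.homEquiv₀.injective ((hhom _).trans (hhom _).symm)⟩
  have h1 : Nontrivial (Abelian.Ext (ModuleCat.of R (ResidueField R)) (ModuleCat.of R M) 1) := by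
    by_contra hcon
    rw [not_nontrivial_iff_subsingleton] at hcon
    let g : M →ₗ[R] M := LinearMap.lsmul R M x
    have hg : Function.Injective g := (injective_iff_map_eq_zero g).2 hxM
    have hS := ModuleCat.shortComplex_shortExact
      (ModuleCat.shortComplexOfCompEqZero g (LinearMap.range g).mkQ
        g.exact_map_mkQ_range.linearMap_comp_eq_zero)
      g.exact_map_mkQ_range hg (Submodule.mkQ_surjective _)
    have hrange : ∀ m : M, x • m ∈ LinearMap.range g := fun m => ⟨m, rfl⟩
    have hnt : Nontrivial (M ⧸ LinearMap.range g) := by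
      rw [Submodule.Quotient.nontrivial_iff]
      intro htop
      have h2 : (⊤ : Submodule R M) ≤ maximalIdeal R • ⊤ := by
        rw [← htop]
        rintro _ ⟨m, rfl⟩
        rw [htop]
        exact Submodule.smul_mem_smul hxm trivial
      have h3 := Submodule.eq_bot_of_le_smul_of_le_jacobson_bot (maximalIdeal R) ⊤
        Module.Finite.fg_top h2 (maximalIdeal_le_jacobson _)
      exact bot_ne_top h3.symm
    obtain ⟨f, hf⟩ := exists_ne_zero_residueField_hom (R := R) (V := M ⧸ LinearMap.range g) (k := k)
      (by
        intro r hr v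
        obtain ⟨m, rfl⟩ := Submodule.mkQ_surjective _ v
        obtain ⟨a, rfl⟩ := Ideal.mem_span_singleton'.1 (hk hr)
        rw [← map_smul, mul_smul]
        exact (Submodule.Quotient.mk_eq_zero _).2 ((LinearMap.range g).smul_mem a (hrange m)))
    obtain ⟨z, hz⟩ := Abelian.Ext.covariant_sequence_exact₃ (ModuleCat.of R (ResidueField R)) hS
      (Abelian.Ext.mk₀ (ModuleCat.ofHom f)) (zero_add 1) (Subsingleton.elim _ _)
    have hz0 : z = 0 := Subsingleton.elim (α := Abelian.Ext (ModuleCat.of R (ResidueField R))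
      (ModuleCat.of R M) 0) _ _
    rw [hz0, Abelian.Ext.zero_comp] at hz
    have h4 := (Abelian.Ext.mk₀_eq_zero_iff _).1 hz.symm
    exact hf (congr_arg (ModuleCat.Hom.hom (R := R)) h4)
  refine le_antisymm (iInf₂_le_of_le 1 h1 le_rfl) (le_iInf₂ fun d hd => ?_)
  rcases Nat.eq_zero_or_pos d with rfl | hd'
  · exact absurd h0 (not_subsingleton_iff_nontrivial.2 hd)
  · exact_mod_cast hd'

theorem isCohenMacaulayModule_of_regular (hR : ringKrullDim R = 1) {x : R} (hx : x ∈ R⁰)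
    (hxm : x ∈ maximalIdeal R) (M : Type u) [AddCommGroup M] [Module R M] [Module.Finite R M]
    [Nontrivial M] (hxM : ∀ m : M, x • m = 0 → m = 0) : IsCohenMacaulayModule R M :=
  ⟨inferInstance, by rw [moduleDepth_eq_one hR hx hxm M hxM, hR]; rfl⟩

theorem exists_mem_maximalIdeal_mem_nonZeroDivisors [IsReduced R] (hR : ringKrullDim R = 1) :
    ∃ x ∈ maximalIdeal R, x ∈ R⁰ := by
  by_contra! h
  have h1 := Ideal.bot_lt_annihilator_of_disjoint_nonZeroDivisors
      (I := maximalIdeal R) (Set.disjoint_left.2 h)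
  refine h1.ne' (eq_bot_iff.2 fun y hy => ?_)
  have hy' : ∀ m ∈ maximalIdeal R, y * m = 0 := fun m hm =>
    congr_arg Subtype.val (Module.mem_annihilator.1 hy ⟨m, hm⟩)
  by_cases hym : y ∈ maximalIdeal R
  · exact IsReduced.eq_zero y ⟨2, by rw [pow_two]; exact hy' y hym⟩
  · have hu : IsUnit y := not_not.1 hym
    have hbot : maximalIdeal R = ⊥ := eq_bot_iff.2 fun m hm => hu.mul_right_eq_zero.1 (hy' m hm)
    rw [ringKrullDim_eq_zero_of_isField (isField_iff_maximalIdeal_eq.2 hbot)] at hR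
    exact absurd hR zero_ne_one

end Depth

/-! ### Overrings inside the total fraction ring -/

section Overring

theorem Subalgebra.mem_nonZeroDivisors_of_isUnit_coe {R Q : Type u} [CommRing R] [CommRing Q] [Algebra R Q]
    (B : Subalgebra R Q) {b : B}
    (hb : IsUnit (b : Q)) : b ∈ B⁰ :=
  mem_nonZeroDivisors_of_injective (f := B.val) Subtype.val_injective hb.mem_nonZeroDivisors

variable {R : Type u} [CommRing R] {Q : Type u} [CommRing Q] [Algebra R Q] [IsFractionRing R Q]

theorem isUnit_algebraMap_iff_mem_nonZeroDivisors {r : R} :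
    IsUnit (algebraMap R Q r) ↔ r ∈ R⁰ := by
  refine ⟨fun h => mem_nonZeroDivisors_of_injective (IsFractionRing.injective R Q)
    h.mem_nonZeroDivisors, fun h => IsLocalization.map_units Q (⟨r, h⟩ : R⁰)⟩

theorem Subalgebra.exists_smul_eq_algebraMap (B : Subalgebra R Q) (b : B) :
    ∃ (d : R⁰) (a : R), (d : R) • b = algebraMap R B a := by
  obtain ⟨a, d, h⟩ := IsLocalization.exists_mk'_eq R⁰ (b : Q)
  refine ⟨d, a, Subtype.ext ?_⟩
  rw [Subalgebra.coe_smul, Algebra.smul_def, ← h, IsLocalization.mk'_spec']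
  rfl

theorem Subalgebra.smul_left_injective (B : Subalgebra R Q) (d : R⁰) {b c : B}
    (h : (d : R) • b = (d : R) • c) : b = c := by
  refine Subtype.ext ((IsLocalization.map_units Q d).mul_left_cancel ?_)
  rw [← Algebra.smul_def, ← Algebra.smul_def]
  exact congr_arg Subtype.val h

theorem Subalgebra.isUnit_coe_of_mem_nonZeroDivisors (B : Subalgebra R Q) {b : B}
    (hb : b ∈ B⁰) : IsUnit (b : Q) := by
  obtain ⟨d, a, h⟩ := B.exists_smul_eq_algebraMap b
  have h' : algebraMap R Q d * b = algebraMap R Q a := by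
    rw [← Algebra.smul_def]
    exact congr_arg Subtype.val h
  have ha : a ∈ R⁰ := by
    rw [mem_nonZeroDivisors_iff_right]
    intro r hr
    have h1 : ((r • (d : R)) • (1 : B)) * b = 0 := by
      rw [smul_mul_assoc, one_mul, smul_assoc, h, Algebra.smul_def, ← map_mul, hr, map_zero]
    have h2 := (mem_nonZeroDivisors_iff.1 hb).2 _ h1
    have h3 : algebraMap R Q (r * d) = 0 := by
      have := congr_arg Subtype.val h2
      rwa [Subalgebra.coe_smul, Algebra.smul_def, Subalgebra.coe_one, mul_one] at this
    rw [← map_zero (algebraMap R Q)] at h3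
    exact (mul_right_mem_nonZeroDivisors_eq_zero_iff d.2).1 (IsFractionRing.injective R Q h3)
  have := isUnit_algebraMap_iff_mem_nonZeroDivisors (Q := Q).2 ha
  rw [← h'] at this
  exact isUnit_of_mul_isUnit_right this

theorem Subalgebra.algebraMap_mem_nonZeroDivisors (B : Subalgebra R Q) {r : R} (hr : r ∈ R⁰) :
    algebraMap R B r ∈ B⁰ :=
  B.mem_nonZeroDivisors_of_isUnit_coe (isUnit_algebraMap_iff_mem_nonZeroDivisors.2 hr)

theorem Subalgebra.isFractionRing_of_isFractionRing (B : Subalgebra R Q) : IsFractionRing B Q where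
  map_units y := B.isUnit_coe_of_mem_nonZeroDivisors y.2
  surj z := by
    obtain ⟨⟨a, s⟩, h⟩ := IsLocalization.surj R⁰ z
    exact ⟨(algebraMap R B a, ⟨algebraMap R B s, B.algebraMap_mem_nonZeroDivisors s.2⟩), h⟩
  exists_of_eq {x y} h := ⟨1, by rw [Subtype.ext h]⟩

/-- After multiplication by a regular `d`, the element `n` becomes an `R`-multiple of `e`, and `d`
can be cancelled in `B`. -/
theorem Subalgebra.linearMap_apply_eq_mul (B : Subalgebra R Q) {N : Type u} [AddCommGroup N]
    [Module R N] (i : N →ₗ[R] B) (hi : Function.Injective i) (e : N) (he : i e = 1)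
    (ψ : N →ₗ[R] B) (n : N) : ψ n = i n * ψ e := by
  obtain ⟨d, a, h⟩ := B.exists_smul_eq_algebraMap (i n)
  have h1 : (d : R) • n = a • e := hi (by
    rw [map_smul, map_smul, h, he, Algebra.algebraMap_eq_smul_one])
  refine B.smul_left_injective d ?_
  rw [← map_smul, h1, ← smul_mul_assoc, h, map_smul, Algebra.smul_def]

/-- Multiplication identifies an overring of `R` inside its total fraction ring with its ring of
`R`-linear endomorphisms. -/
noncomputable def Subalgebra.endRingEquiv (B : Subalgebra R Q) : B ≃+* Module.End R B :=
  RingEquiv.ofBijective (Algebra.lmul R B) ⟨fun a b h => by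
    have := LinearMap.congr_fun h 1
    simpa using this, fun ψ => ⟨ψ 1, by
    ext1 b
    rw [B.linearMap_apply_eq_mul LinearMap.id Function.injective_id 1 rfl ψ b]
    exact mul_comm _ _⟩⟩

theorem Subalgebra.exists_smul_mem_range (B : Subalgebra R Q) [Module.Finite R B] :
    ∃ d : R⁰, ∀ b : B, ∃ a : R, (d : R) • b = algebraMap R B a := by
  classical
  obtain ⟨s, hs⟩ := (Module.Finite.fg_top : (⊤ : Submodule R B).FG)
  obtain ⟨d, hd⟩ := IsLocalization.exist_integer_multiples_of_finset R⁰ (s.image (B.val))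
  refine ⟨d, fun b => ?_⟩
  have hb : b ∈ Submodule.span R (s : Set B) := hs ▸ trivial
  induction hb using Submodule.span_induction with
  | mem b hb =>
    obtain ⟨a, ha⟩ := hd b (Finset.mem_image_of_mem _ hb)
    exact ⟨a, Subtype.ext ha.symm⟩
  | zero => exact ⟨0, by simp⟩
  | add b c _ _ hb hc =>
    obtain ⟨a, ha⟩ := hb
    obtain ⟨a', ha'⟩ := hc
    exact ⟨a + a', by rw [smul_add, ha, ha', map_add]⟩
  | smul r b _ hb =>
    obtain ⟨a, ha⟩ := hb
    exact ⟨r * a, by rw [smul_comm, ha, map_mul, Algebra.smul_def]⟩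

end Overring

/-! ### The conductor of a maximal subalgebra -/

section Conductor

/-- The conductor of a subalgebra `S` of `B`: the largest ideal of `B` contained in `S`. -/
def Subalgebra.conductorIdeal {R B : Type u} [CommRing R] [CommRing B] [Algebra R B]
    (S : Subalgebra R B) : Ideal B where
  carrier := {y | ∀ b, b * y ∈ S}
  add_mem' := fun hx hy b => by rw [mul_add]; exact add_mem (hx b) (hy b)
  zero_mem' := fun b => by rw [mul_zero]; exact S.zero_mem
  smul_mem' := fun c x hx b => by rw [smul_eq_mul, ← mul_assoc]; exact hx _

variable {R B : Type u} [CommRing R] [CommRing B] [Algebra R B]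

theorem Subalgebra.mem_of_mem_conductorIdeal (S : Subalgebra R B) :
    ∀ y ∈ S.conductorIdeal, y ∈ S.toSubring := fun y hy => by
  have := hy 1
  rwa [one_mul] at this

/-- For a maximal ideal `𝔫` of `S` above the conductor, `S + 𝔫B` is `S` or `B`. If it is `S`, then
`𝔫B ⊆ S` and `𝔫` lies in the conductor. If it is `B`, Nakayama on `B/S` gives `r ≡ 1` modulo `𝔫`
with `rB ⊆ S`, so `r ∈ 𝔫`, a contradiction. -/
theorem Subalgebra.conductorIdeal_isMaximal_of_isCoatom [Module.Finite R B] (S : Subalgebra R B)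
    (hS : IsCoatom S) : (S.conductorIdeal.comap S.toSubring.subtype).IsMaximal := by
  have hne : S.conductorIdeal.comap S.toSubring.subtype ≠ ⊤ := by
    rw [Ideal.ne_top_iff_one]
    intro h
    refine hS.1 (eq_top_iff.2 fun b _ => ?_)
    have := h b
    rwa [map_one, mul_one] at this
  obtain ⟨𝔫, h𝔫, hle⟩ := Ideal.exists_le_maximal _ hne
  suffices 𝔫 ≤ S.conductorIdeal.comap S.toSubring.subtype by
    rwa [le_antisymm hle this]
  let I : Ideal B := 𝔫.map S.toSubring.subtype
  let S₁ : Subalgebra R B :=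
    { carrier := {b | ∃ s ∈ S, b - s ∈ I}
      mul_mem' := by
        rintro a b ⟨s, hs, has⟩ ⟨t, ht, hbt⟩
        refine ⟨s * t, mul_mem hs ht, ?_⟩
        rw [show a * b - s * t = b * (a - s) + s * (b - t) by ring]
        exact add_mem (I.mul_mem_left _ has) (I.mul_mem_left _ hbt)
      add_mem' := by
        rintro a b ⟨s, hs, has⟩ ⟨t, ht, hbt⟩
        refine ⟨s + t, add_mem hs ht, ?_⟩
        rw [add_sub_add_comm]
        exact add_mem has hbt
      algebraMap_mem' := fun r => ⟨_, S.algebraMap_mem r, by rw [sub_self]; exact I.zero_mem⟩ }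
  have hSS₁ : S ≤ S₁ := fun s hs => ⟨s, hs, by rw [sub_self]; exact I.zero_mem⟩
  rcases hS.le_iff.1 hSS₁ with htop | heq
  · exfalso
    have : Module.Finite S.toSubring B := Module.Finite.of_restrictScalars_finite R S B
    let N : Submodule S.toSubring B := 1
    have hN : ∀ b, b ∈ N ↔ b ∈ S := fun b => by
      rw [Submodule.mem_one]
      exact ⟨fun ⟨s, hs⟩ => hs ▸ s.2, fun hb => ⟨⟨b, hb⟩, rfl⟩⟩
    obtain ⟨r, hr, hrB⟩ := Submodule.exists_sub_one_mem_and_smul_eq_zero_of_fg_of_le_smul 𝔫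
      (⊤ : Submodule S.toSubring (B ⧸ N)) Module.Finite.fg_top (by
        rintro v -
        obtain ⟨b, rfl⟩ := N.mkQ_surjective v
        obtain ⟨s, hs, hbs⟩ : b ∈ S₁ := htop ▸ trivial
        have h1 : N.mkQ b = N.mkQ (b - s) := by
          rw [map_sub, eq_comm, sub_eq_self]
          exact (Submodule.Quotient.mk_eq_zero N).2 ((hN s).2 hs)
        have h2 : b - s ∈ 𝔫 • (⊤ : Submodule S.toSubring B) := by
          rw [Ideal.smul_top_eq_map]
          exact hbs
        have h3 := Submodule.mem_map_of_mem (f := N.mkQ) h2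
        rw [Submodule.map_smul''] at h3
        rw [h1]
        exact Submodule.smul_mono le_rfl le_top h3)
    have hrC : r ∈ S.conductorIdeal.comap S.toSubring.subtype := by
      intro b
      have := hrB (N.mkQ b) trivial
      rw [← map_smul] at this
      have := (hN _).1 ((Submodule.Quotient.mk_eq_zero N).1 this)
      rwa [mul_comm]
    refine h𝔫.ne_top ((Ideal.eq_top_iff_one _).2 ?_)
    have := 𝔫.sub_mem (hle hrC) hr
    rwa [sub_sub_cancel] at this
  · intro y hy b
    have : b * y.1 ∈ S₁ := ⟨0, S.zero_mem, by
      rw [sub_zero]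
      exact I.mul_mem_left _ (Ideal.mem_map_of_mem S.toSubring.subtype hy)⟩
    rwa [heq] at this

/-- By Nakayama, idempotence gives `r ≡ 1` modulo the conductor that kills it; the regular `d`
forces `r = 0`, so the conductor is all of `B`. -/
theorem Subalgebra.conductorIdeal_mul_self_ne [IsNoetherianRing B] (S : Subalgebra R B)
    (hS : S ≠ ⊤) {d : B} (hd : d ∈ B⁰) (hdS : d ∈ S.conductorIdeal) :
    S.conductorIdeal * S.conductorIdeal ≠ S.conductorIdeal := by
  intro h
  obtain ⟨r, hr, hr0⟩ := Submodule.exists_sub_one_mem_and_smul_eq_zero_of_fg_of_le_smul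
    S.conductorIdeal S.conductorIdeal (IsNoetherian.noetherian _) h.ge
  have h0 : r = 0 := (mem_nonZeroDivisors_iff_right.1 hd) _ (hr0 d hdS)
  rw [h0, zero_sub, Ideal.neg_mem_iff] at hr
  refine hS (eq_top_iff.2 fun b _ => ?_)
  have := hr b
  rwa [mul_one] at this

end Conductor

/-! ### The conductor order as an endomorphism ring -/

section MatrixEnd

variable {R : Type u} [CommRing R] {Q : Type u} [CommRing Q] [Algebra R Q] [IsFractionRing R Q]

/-- The matrices in the conductor order of `S` act on `S × B`. -/
def Subalgebra.conductorOrderToEnd {R B : Type u} [CommRing R] [CommRing B] [Algebra R B]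
    (S : Subalgebra R B) :
    conductorOrder S.toSubring S.conductorIdeal S.mem_of_mem_conductorIdeal →+*
      Module.End R (S × B) where
  toFun X :=
    { toFun w := (⟨X.1 0 0 * w.1 + X.1 0 1 * w.2, add_mem (mul_mem X.2.1 w.1.2)
        (mul_comm (X.1 0 1) w.2 ▸ X.2.2 w.2)⟩, X.1 1 0 * w.1 + X.1 1 1 * w.2)
      map_add' v w := by
        refine Prod.ext (Subtype.ext ?_) ?_ <;> simp <;> ring
      map_smul' r w := by
        refine Prod.ext (Subtype.ext ?_) ?_ <;> simp }
  map_one' := by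
    refine LinearMap.ext fun w => Prod.ext (Subtype.ext ?_) ?_ <;> simp
  map_zero' := by
    refine LinearMap.ext fun w => Prod.ext (Subtype.ext ?_) ?_ <;> simp
  map_add' X Y := by
    refine LinearMap.ext fun w => Prod.ext (Subtype.ext ?_) ?_ <;> simp <;> ring
  map_mul' X Y := by
    refine LinearMap.ext fun w => Prod.ext (Subtype.ext ?_) ?_ <;>
      simp [Matrix.mul_apply, Fin.sum_univ_two] <;> ring

theorem Subalgebra.conductorOrderToEnd_injective {R B : Type u} [CommRing R] [CommRing B]
    [Algebra R B] (S : Subalgebra R B) : Function.Injective S.conductorOrderToEnd := by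
  intro X Y h
  have h1 := LinearMap.congr_fun h (1, 0)
  have h2 := LinearMap.congr_fun h (0, 1)
  simp [conductorOrderToEnd, Prod.ext_iff] at h1 h2
  refine Subtype.ext (Matrix.ext fun i j => ?_)
  fin_cases i <;> fin_cases j
  exacts [h1.1, h2.1, h1.2, h2.2]

theorem Subalgebra.conductorOrderToEnd_surjective (B : Subalgebra R Q) (S : Subalgebra R B) :
    Function.Surjective S.conductorOrderToEnd := by
  intro φ
  let j : S →ₗ[R] B := S.val.toLinearMap
  have hj : Function.Injective j := Subtype.val_injective
  have hS : ∀ (ψ : S →ₗ[R] B) (s : S), ψ s = s * ψ 1 :=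
    B.linearMap_apply_eq_mul j hj 1 rfl
  have hB : ∀ (ψ : B →ₗ[R] B) (b : B), ψ b = b * ψ 1 :=
    B.linearMap_apply_eq_mul LinearMap.id Function.injective_id 1 rfl
  have h00 := hS (j ∘ₗ LinearMap.fst R S B ∘ₗ φ ∘ₗ LinearMap.inl R S B)
  have h01 := hB (j ∘ₗ LinearMap.fst R S B ∘ₗ φ ∘ₗ LinearMap.inr R S B)
  have h10 := hS (LinearMap.snd R S B ∘ₗ φ ∘ₗ LinearMap.inl R S B)
  have h11 := hB (LinearMap.snd R S B ∘ₗ φ ∘ₗ LinearMap.inr R S B)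
  -- The upper right entry lies in the conductor because its product with each `b` is the
  -- `S`-component of `φ (0, b)`.
  refine ⟨conductorOrder.mk ((φ (1, 0)).1 : B) (φ (1, 0)).1.2 ((φ (0, 1)).1 : B)
    (fun b => h01 b ▸ (φ (0, b)).1.2) (φ (1, 0)).2 (φ (0, 1)).2, ?_⟩
  refine LinearMap.ext fun ⟨s, b⟩ => ?_
  have hsb : ((s, b) : S × B) = (s, 0) + (0, b) := by simp
  rw [hsb, map_add φ]
  refine Prod.ext (Subtype.ext ?_) ?_
  · refine Eq.trans ?_ (congr_arg₂ (· + ·) (h00 s) (h01 b)).symm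
    simp [conductorOrderToEnd, conductorOrder.mk, j, mul_comm]
  · refine Eq.trans ?_ (congr_arg₂ (· + ·) (h10 s) (h11 b)).symm
    simp [conductorOrderToEnd, conductorOrder.mk, mul_comm]

/-- The conductor order of `S` is the ring of `R`-linear endomorphisms of `S × B`. -/
noncomputable def Subalgebra.conductorOrderEquivEnd (B : Subalgebra R Q) (S : Subalgebra R B) :
    conductorOrder S.toSubring S.conductorIdeal S.mem_of_mem_conductorIdeal ≃+*
      Module.End R (S × B) :=
  RingEquiv.ofBijective S.conductorOrderToEnd
    ⟨S.conductorOrderToEnd_injective, B.conductorOrderToEnd_surjective S⟩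

end MatrixEnd

/-! ### Assembly: the normalization and a maximal subalgebra -/

section Normalization

open IsLocalRing

variable {R : Type u} [CommRing R]

theorem Ideal.IsPrime.isMaximal_of_mem_nonZeroDivisors [IsLocalRing R] (hR : ringKrullDim R = 1)
    (p : Ideal R) (hp : p.IsPrime) (x : R) (hxp : x ∈ p) (hx : x ∈ R⁰) : p.IsMaximal := by
  have := Ring.KrullDimLE.of_ringKrullDim_eq_one hR
  refine (Ring.krullDimLE_one_iff.1 this p hp).resolve_left fun hmin => ?_
  exact Set.disjoint_left.1 (Ideal.disjoint_nonZeroDivisors_of_mem_minimalPrimes hmin) hxp hx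

variable {Q : Type u} [CommRing Q] [Algebra R Q] [IsFractionRing R Q]

theorem Subalgebra.isMaximal_of_mem_nonZeroDivisors [IsLocalRing R] (hR : ringKrullDim R = 1)
    (B : Subalgebra R Q) [Algebra.IsIntegral R B] (p : Ideal B) (hp : p.IsPrime) (y : B)
    (hyp : y ∈ p) (hy : y ∈ B⁰) : p.IsMaximal := by
  obtain ⟨d, a, h⟩ := B.exists_smul_eq_algebraMap y
  have ha : a ∈ R⁰ := by
    rw [← isUnit_algebraMap_iff_mem_nonZeroDivisors (Q := Q)]
    have h1 : algebraMap R Q a = algebraMap R Q d * y := by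
      rw [← Algebra.smul_def]
      exact (congr_arg Subtype.val h).symm
    rw [h1]
    exact (IsLocalization.map_units Q d).mul (B.isUnit_coe_of_mem_nonZeroDivisors hy)
  refine Ideal.isMaximal_of_isIntegral_of_isMaximal_comap (R := R) p ?_
  refine Ideal.IsPrime.isMaximal_of_mem_nonZeroDivisors hR _ (Ideal.IsPrime.comap _) a ?_ ha
  rw [Ideal.mem_comap, ← h, Algebra.smul_def]
  exact p.mul_mem_left _ hyp

theorem globalDimension_integralClosure_eq_one [IsLocalRing R] [IsNoetherianRing R] [IsReduced Q]
    (hR : ringKrullDim R = 1) [Module.Finite R (integralClosure R Q)] {x : R}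
    (hx : x ∈ R⁰) (hxm : x ∈ maximalIdeal R) : globalDimension (integralClosure R Q) = 1 := by
  have := IsNoetherianRing.of_finite R (integralClosure R Q)
  have := (integralClosure R Q).isFractionRing_of_isFractionRing
  have : IsReduced (integralClosure R Q) :=
    isReduced_of_injective (integralClosure R Q).val Subtype.val_injective
  refine le_antisymm (globalDimension_le_one_of_integrallyClosed Q
    (Subalgebra.isMaximal_of_mem_nonZeroDivisors hR _) fun q hq =>
      ⟨⟨q, isIntegral_trans (A := integralClosure R Q) q hq⟩, rfl⟩)
    (one_le_globalDimension
      ((integralClosure R Q).algebraMap_mem_nonZeroDivisors hx) fun hu => ?_)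
  have : FaithfulSMul R (integralClosure R Q) :=
    (faithfulSMul_iff_algebraMap_injective _ _).2 fun a b h =>
      IsFractionRing.injective R Q (congr_arg Subtype.val h)
  have := Algebra.IsIntegral.isLocalHom R (integralClosure R Q)
  exact (mem_maximalIdeal x).1 hxm (isUnit_of_map_unit (algebraMap R (integralClosure R Q)) x hu)

theorem bot_ne_top_of_not_isRegularLocalRing [IsLocalRing R] [IsNoetherianRing R]
    (hR : ringKrullDim R = 1) (hsing : ¬ IsRegularLocalRing R) {x : R}
    (hx : x ∈ R⁰) (hxm : x ∈ maximalIdeal R) :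
    (⊥ : Subalgebra R (integralClosure R Q)) ≠ ⊤ := by
  intro h
  refine hsing (isRegularLocalRing_of_integrallyClosed Q hR.ge
    (Ideal.IsPrime.isMaximal_of_mem_nonZeroDivisors hR) (fun q hq => ?_) hx hxm)
  obtain ⟨r, hr⟩ := Algebra.mem_bot.1
    (show (⟨q, hq⟩ : integralClosure R Q) ∈ (⊥ : Subalgebra R _) from h ▸ trivial)
  exact ⟨r, congr_arg Subtype.val hr⟩

theorem Subalgebra.exists_isCoatom {R B : Type u} [CommRing R] [CommRing B] [Algebra R B]
    [IsNoetherian R B] (h : (⊥ : Subalgebra R B) ≠ ⊤) : ∃ S : Subalgebra R B, IsCoatom S := by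
  have : WellFoundedGT (Subalgebra R B) :=
    StrictMono.wellFoundedGT (f := Subalgebra.toSubmodule) fun _ _ h => h
  obtain ⟨S, hS, -⟩ := (eq_top_or_exists_le_coatom (⊥ : Subalgebra R B)).resolve_left h
  exact ⟨S, hS⟩

theorem globalDimension_end_prod_eq_two (B : Subalgebra R Q) [IsNoetherianRing R]
    [Module.Finite R B] (hB : globalDimension B ≤ 1) (S : Subalgebra R B) (hS : IsCoatom S) :
    globalDimension (Module.End R (S × B)) = 2 := by
  have := IsNoetherianRing.of_finite R B
  obtain ⟨d, hd⟩ := B.exists_smul_mem_range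
  rw [← globalDimension_eq_of_ringEquiv (B.conductorOrderEquivEnd S)]
  refine conductorOrder.globalDimension_eq_two (S.conductorIdeal_isMaximal_of_isCoatom hS) hB
    (fun y hy => hy) (S.conductorIdeal_mul_self_ne hS.1 (B.algebraMap_mem_nonZeroDivisors d.2)
      fun b => ?_)
  obtain ⟨a, ha⟩ := hd b
  rw [mul_comm, ← Algebra.smul_def, ha]
  exact S.algebraMap_mem a

theorem globalDimension_end_map_prod_eq_two (B : Subalgebra R Q) [IsNoetherianRing R]
    [Module.Finite R B] (hB : globalDimension B ≤ 1) (S : Subalgebra R B) (hS : IsCoatom S) :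
    globalDimension (Module.End R ((S.map B.val) × B)) = 2 := by
  let e : (S.map B.val) ≃ₗ[R] S :=
    (S.equivMapOfInjective B.val Subtype.val_injective).symm.toLinearEquiv
  rw [← globalDimension_end_prod_eq_two B hB S hS]
  exact globalDimension_eq_of_ringEquiv (e.prodCongr (LinearEquiv.refl R B)).conjRingEquiv

theorem Subalgebra.finite_map_val {R Q : Type u} [CommRing R] [CommRing Q] [Algebra R Q]
    [IsNoetherianRing R] {B : Subalgebra R Q} [Module.Finite R B] (S : Subalgebra R B) :
    Module.Finite R (S.map B.val) :=
  have : Module.Finite R S := Module.Finite.of_injective S.val.toLinearMap Subtype.val_injective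
  Module.Finite.equiv (S.equivMapOfInjective B.val Subtype.val_injective).toLinearEquiv

end Normalization

theorem lemma5p1 (R : Type u) [CommRing R] [IsLocalRing R] [IsNoetherianRing R]
    [IsAdicComplete (IsLocalRing.maximalIdeal R) R] [IsReduced R]
    (hCM : IsCohenMacaulayModule R R) (hdim : ringKrullDim R = 1)
    (hsing : ¬ IsRegularLocalRing R) :
    ({1, 2} : Set ℕ) ⊆ globalSpectrum R ∧
    (IsCohenMacaulayModule R (normalization R) ∧
      IsNoncommutativeResolution R (normalization R) ∧
      globalDimension (Module.End R (normalization R)) = 1) ∧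
    ∃ S : Subalgebra R (FractionRing R), S ≤ normalization R ∧
      IsCohenMacaulayModule R (S × normalization R) ∧
      IsNoncommutativeResolution R (S × normalization R) ∧
      globalDimension (Module.End R (S × normalization R)) = 2 := by
  obtain ⟨x, hxm, hx⟩ := exists_mem_maximalIdeal_mem_nonZeroDivisors hdim
  have hfin : Module.Finite R (normalization R) := finite_integralClosure hdim hx hxm
  have hfaithful : FaithfulSMul R (normalization R) :=
    (faithfulSMul_iff_algebraMap_injective _ _).2 fun a b h =>
      IsFractionRing.injective R (FractionRing R) (congr_arg Subtype.val h)
  have hreg : ∀ (T : Subalgebra R (FractionRing R)) (t : T), x • t = 0 → t = 0 :=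
    fun T t h => T.smul_left_injective ⟨x, hx⟩ (h.trans (smul_zero x).symm)
  have hgl : globalDimension (normalization R) = 1 :=
    globalDimension_integralClosure_eq_one hdim hx hxm
  have hgl₁ : globalDimension (Module.End R (normalization R)) = 1 := by
    rw [← globalDimension_eq_of_ringEquiv (normalization R).endRingEquiv]
    exact hgl
  have hCM₁ : IsCohenMacaulayModule R (normalization R) :=
    isCohenMacaulayModule_of_regular hdim hx hxm _ (hreg _)
  obtain ⟨S₀, hS₀⟩ := Subalgebra.exists_isCoatom
    (bot_ne_top_of_not_isRegularLocalRing (Q := FractionRing R) hdim hsing hx hxm)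
  have hle : S₀.map (normalization R).val ≤ normalization R := by
    rintro _ ⟨b, -, rfl⟩
    exact b.2
  have hgl₂ := globalDimension_end_map_prod_eq_two (normalization R) hgl.le S₀ hS₀
  have hfin₂ := S₀.finite_map_val (B := normalization R)
  have hCM₂ : IsCohenMacaulayModule R ((S₀.map (normalization R).val) × normalization R) :=
    isCohenMacaulayModule_of_regular hdim hx hxm _ fun m h =>
      Prod.ext (hreg _ _ (congr_arg Prod.fst h)) (hreg _ _ (congr_arg Prod.snd h))
  refine ⟨?_, ⟨hCM₁, ⟨hfin, hfaithful, ?_⟩, hgl₁⟩, S₀.map (normalization R).val, hle, hCM₂,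
    ⟨inferInstance, inferInstance, ?_⟩, hgl₂⟩
  · rintro n (rfl | rfl)
    · exact ⟨_, _, _, hCM₁, hgl₁⟩
    · exact ⟨_, _, _, hCM₂, hgl₂⟩
  · rw [hgl₁]
    decide
  · rw [hgl₂]
    decide
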